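/- **Setting.** Let $\phi:\mathbb R\to[0,\infty]$ be a closed (lower semicontinuous) convex function with $\phi(1)=0$, with $1$ in the interior of its domain $\{\phi<\infty\}$, strictly convex and four times continuously differentiable on the interior of its domain, and essentially smooth ($|\phi'(x)|\to\infty$ as $x$ tends, from inside, to a finite endpoint of the domain). Let $\{P_\theta:\theta\in\Theta\}$, $\Theta\subset\mathbb R^d$, be an identifiable family of probability measures with densities $p_\theta\ge 0$ with respect to a $\sigma$-finite measure $\lambda$. Assume that for $\lambda$-a.e. $x$: $\theta\mapsto p_\theta(x)$ is three times continuously differentiable on the interior of $\Theta$; $p_\theta(x)$ is positive for all $\theta\in\Theta$ or for none; and, in the first case, $p_\theta(x)/p_\alpha(x)$ lies in the interior of the domain of $\phi$ for all $\theta,\alpha\in\Theta$. Assume $\int|\phi'(p_\theta/p_\alpha)|\,dP_\theta<\infty$ for all $\theta,\alpha\in\Theta$. Let $X_1,X_2,\dots$ be i.i.d. with law $P_{\theta_T}$, $\theta_T$ an interior point of $\Theta$, let $P_n$ be the empirical measure of $X_1,\dots,X_n$, and write $Pk=\int k\,dP$. Put $$f(\theta,\alpha,x)=\phi'\Big(\tfrac{p_\theta(x)}{p_\alpha(x)}\Big),\qquad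 g(\theta,\alpha,x)=\tfrac{p_\theta(x)}{p_\alpha(x)}\,\phi'\Big(\tfrac{p_\theta(x)}{p_\alpha(x)}\Big)-\phi\Big(\tfrac{p_\theta(x)}{p_\alpha(x)}\Big),\qquad h(\theta,\alpha,x)=P_\theta f(\theta,\alpha)-g(\theta,\alpha,x).$$ Let $\Theta_0=s(B_0)\subset\Theta$, where $B_0\subset\mathbb R^{m}$ is open and $s:B_0\to\mathbb R^d$ is continuously differentiable with Jacobian matrix of rank $m$ at every point. Let $$D_\phi(\theta,\theta_T)=\int\phi(p_\theta/p_{\theta_T})\,dP_{\theta_T},\qquad D_\phi(\Theta_0,\theta_T)=\inf_{\theta\in\Theta_0}D_\phi(\theta,\theta_T),\qquad \widehat D_\phi(\Theta_0,\theta_T)=\inf_{\beta\in B_0}\sup_{\alpha\in\Theta}P_nh(s(\beta),\alpha).$$ Let $\hat\beta=\hat\beta_n$ denote a minimizer of $\beta\mapsto\sup_{\alpha\in\Theta}P_nh(s(\beta),\alpha)$ over $B_0$, and for $\beta\in B_0$ let $\hat\alpha(\beta)=\hat\alpha_n(\beta)$ denote a maximizer of $\alpha\mapsto P_nh(s(\beta),\alpha)$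 over $\Theta$. The statistics $\hat\beta$, $\hat\alpha(\hat\beta)$ and $\widehat D_\phi(\Theta_0,\theta_T)$ are assumed measurable. **Conditions.** (C.1) The minimum of $D_\phi(\cdot,\theta_T)$ on $\Theta_0$ is attained at $s(\beta^*)$ with $\beta^*\in B_0$. (C.2) There are neighborhoods $N(\beta^*)\subset B_0$ of $\beta^*$ and $N(\theta_T)\subset\Theta$ of $\theta_T$ such that, for $\lambda$-a.e. $x$, $(\beta,\alpha)\mapsto f(s(\beta),\alpha,x)\,p_{s(\beta)}(x)$ is twice continuously differentiable on $N(\beta^*)\times N(\theta_T)$, its first and second order partial derivatives being dominated there by a $\lambda$-integrable function of $x$; and, for $P_{\theta_T}$-a.e. $x$, $(\beta,\alpha)\mapsto h(s(\beta),\alpha,x)$ is three times continuously differentiable there, its third order partial derivatives being dominated by a $P_{\theta_T}$-integrable function of $x$. (C.3) At $(\beta^*,\theta_T)$ the first order partial derivatives of $h(s(\beta),\alpha,\cdot)$ in $(\beta,\alpha)$ are square integrable and the second order ones are integrable with respect to $P_{\theta_T}$, and the matrix $$A=P_{\theta_T}\,\nabla^2_{(\beta,\alpha)}h(s(\beta),\alpha)\big|_{(\beta^*,\theta_T)}$$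 is nonsingular. (C.4) $P_{\theta_T}h(s(\beta^*),\theta_T)^2<\infty$. (C.5) With probability tending to $1$, $\hat\beta_n$ exists, and $\hat\beta_n\to\beta^*$ in probability. For every $\varepsilon>0$, with probability tending to $1$ there is a neighborhood of $\hat\beta_n$ (possibly depending on $n$ and on the sample) such that for all $\beta$ in it $\hat\alpha_n(\beta)$ exists and $\|\hat\alpha_n(\beta)-\theta_T\|<\varepsilon$. (In particular $\hat\alpha_n(\hat\beta_n)\to\theta_T$ in probability.) **Theorem.** Assume (C.1)–(C.5) and $\theta_T\notin\Theta_0$. Put $c_n=(\hat\beta^T,\hat\alpha(\hat\beta)^T)^T$, $c^*=(\beta^{*T},\theta_T^T)^T$ and $$F=P_{\theta_T}\Big[\nabla_{(\beta,\alpha)}h(s(\beta),\alpha)\;\nabla_{(\beta,\alpha)}h(s(\beta),\alpha)^T\Big]\Big|_{(\beta^*,\theta_T)}.$$ Then: (a) $\sqrt n\,(c_n-c^*)$ converges in distribution to the centered normal law with covariance matrix $A^{-1}FA^{-1}$. (b) $D_\phi(\Theta_0,\theta_T)$ is finite, and $\sqrt n\,\big(\widehat D_\phi(\Theta_0,\theta_T)-D_\phi(\Theta_0,\theta_T)\big)$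 converges in distribution to the centered normal law with variance $$P_{\theta_T}h(s(\beta^*),\theta_T)^2-\big(P_{\theta_T}h(s(\beta^*),\theta_T)\big)^2 .$$ -/

import Mathlib

open MeasureTheory ProbabilityTheory Filter Topology Set
open scoped ENNReal NNReal

noncomputable section

namespace PhiDivergence

/-! ### The convex function -/

/-- The effective domain of a `[0, ∞]`-valued function. -/
def dom (φ : ℝ → ℝ≥0∞) : Set ℝ := {x | φ x ≠ ∞}

/-- The real-valued version of `φ`; it is only meaningful on `dom φ`. -/
def realPart (φ : ℝ → ℝ≥0∞) : ℝ → ℝ := fun x => (φ x).toReal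

/-- A closed convex `φ : ℝ → [0, ∞]` with `φ 1 = 0` whose domain is an interval having `1` in its
interior, which is strictly convex, essentially smooth (its derivative blows up at each finite end
point of the domain), and four times continuously differentiable inside its domain. -/
structure IsDivergenceFunction (φ : ℝ → ℝ≥0∞) : Prop where
  map_one : φ 1 = 0
  convex : ∀ x y t : ℝ, 0 ≤ t → t ≤ 1 →
    φ (t * x + (1 - t) * y) ≤ ENNReal.ofReal t * φ x + ENNReal.ofReal (1 - t) * φ y
  closed : LowerSemicontinuous φ
  one_mem_interior : (1 : ℝ) ∈ interior (dom φ)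
  strictConvex : StrictConvexOn ℝ (interior (dom φ)) (realPart φ)
  contDiff : ContDiffOn ℝ 4 (realPart φ) (interior (dom φ))
  essentiallySmooth : ∀ a ∈ frontier (dom φ),
    Tendsto (fun x => |deriv (realPart φ) x|) (𝓝[interior (dom φ)] a) atTop

variable {𝒳 : Type*} [MeasurableSpace 𝒳]

section Model

variable {d : ℕ}

/-- The measure `P_θ = p_θ ν`. -/
def law (ν : Measure 𝒳) (p : EuclideanSpace ℝ (Fin d) → 𝒳 → ℝ) (θ : EuclideanSpace ℝ (Fin d)) :
    Measure 𝒳 := ν.withDensity (fun x => ENNReal.ofReal (p θ x))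

/-- `f(θ, α, x) = φ'(p_θ(x) / p_α(x))`. -/
def fFun (φ : ℝ → ℝ≥0∞) (p : EuclideanSpace ℝ (Fin d) → 𝒳 → ℝ)
    (θ α : EuclideanSpace ℝ (Fin d)) (x : 𝒳) : ℝ :=
  deriv (realPart φ) (p θ x / p α x)

/-- `g(θ, α, x) = u φ'(u) - φ(u)` with `u = p_θ(x) / p_α(x)`. -/
def gFun (φ : ℝ → ℝ≥0∞) (p : EuclideanSpace ℝ (Fin d) → 𝒳 → ℝ)
    (θ α : EuclideanSpace ℝ (Fin d)) (x : 𝒳) : ℝ :=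
  p θ x / p α x * deriv (realPart φ) (p θ x / p α x) - realPart φ (p θ x / p α x)

/-- `h(θ, α, x) = P_θ f(θ, α) - g(θ, α, x)`. -/
def hFun (φ : ℝ → ℝ≥0∞) (ν : Measure 𝒳) (p : EuclideanSpace ℝ (Fin d) → 𝒳 → ℝ)
    (θ α : EuclideanSpace ℝ (Fin d)) (x : 𝒳) : ℝ :=
  (∫ y, fFun φ p θ α y ∂(law ν p θ)) - gFun φ p θ α x

/-- The `φ`-divergence `D_φ(θ, α) = ∫ φ(p_θ / p_α) dP_α ∈ [0, ∞]`. -/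
def divergence (φ : ℝ → ℝ≥0∞) (ν : Measure 𝒳) (p : EuclideanSpace ℝ (Fin d) → 𝒳 → ℝ)
    (θ α : EuclideanSpace ℝ (Fin d)) : ℝ≥0∞ :=
  ∫⁻ x, φ (p θ x / p α x) ∂(law ν p α)

/-- `D_φ(Θ₀, α) = inf_{θ ∈ Θ₀} D_φ(θ, α)`. -/
def divergenceFrom (φ : ℝ → ℝ≥0∞) (ν : Measure 𝒳) (p : EuclideanSpace ℝ (Fin d) → 𝒳 → ℝ)
    (Θ₀ : Set (EuclideanSpace ℝ (Fin d))) (α : EuclideanSpace ℝ (Fin d)) : ℝ≥0∞ :=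
  ⨅ θ ∈ Θ₀, divergence φ ν p θ α

/-- The standing assumptions on the parametric model `{P_θ : θ ∈ Θ}`: densities with respect to
`ν`, identifiability, common support, smoothness in the parameter, and `φ'(p_θ / p_α)` well defined
(the ratio lies in the interior of the domain of `φ` on the common support) and
`P_θ`-integrable. -/
structure IsModel (φ : ℝ → ℝ≥0∞) (ν : Measure 𝒳) (Θ : Set (EuclideanSpace ℝ (Fin d)))
    (p : EuclideanSpace ℝ (Fin d) → 𝒳 → ℝ) : Prop where
  measurable : ∀ θ ∈ Θ, Measurable (p θ)
  nonneg : ∀ θ ∈ Θ, ∀ x, 0 ≤ p θ x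
  isProbabilityMeasure : ∀ θ ∈ Θ, IsProbabilityMeasure (law ν p θ)
  identifiable : InjOn (law ν p) Θ
  support : ∀ᵐ x ∂ν, ∀ θ ∈ Θ, ∀ α ∈ Θ, 0 < p θ x → 0 < p α x
  contDiff : ∀ᵐ x ∂ν, ContDiffOn ℝ 3 (fun θ => p θ x) (interior Θ)
  ratio_mem : ∀ᵐ x ∂ν, ∀ θ ∈ Θ, ∀ α ∈ Θ, 0 < p θ x → p θ x / p α x ∈ interior (dom φ)
  integrable : ∀ θ ∈ Θ, ∀ α ∈ Θ, Integrable (fFun φ p θ α) (law ν p θ)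

end Model

section Composite

variable {m d : ℕ}

/-- `Θ₀ = s(B₀) ⊆ Θ` with `B₀ ⊆ ℝᵐ` open and `s` continuously differentiable on `B₀`, its Jacobian
matrix having full rank `m`. -/
structure IsParametrization (Θ Θ₀ : Set (EuclideanSpace ℝ (Fin d)))
    (B₀ : Set (EuclideanSpace ℝ (Fin m)))
    (s : EuclideanSpace ℝ (Fin m) → EuclideanSpace ℝ (Fin d)) : Prop where
  isOpen : IsOpen B₀
  image_eq : s '' B₀ = Θ₀
  subset : Θ₀ ⊆ Θ
  contDiff : ContDiffOn ℝ 1 s B₀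
  rank : ∀ β ∈ B₀, Function.Injective (fderiv ℝ s β)

/-- The vector `(βᵀ, αᵀ)ᵀ`. -/
def joint (β : EuclideanSpace ℝ (Fin m)) (α : EuclideanSpace ℝ (Fin d)) :
    EuclideanSpace ℝ (Fin m ⊕ Fin d) :=
  WithLp.toLp 2 (Sum.elim (fun i => β i) (fun j => α j))

/-- The `β`-block of a joint vector. -/
def betaPart (c : EuclideanSpace ℝ (Fin m ⊕ Fin d)) : EuclideanSpace ℝ (Fin m) :=
  WithLp.toLp 2 (fun i => c (Sum.inl i))

/-- The `α`-block of a joint vector. -/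
def alphaPart (c : EuclideanSpace ℝ (Fin m ⊕ Fin d)) : EuclideanSpace ℝ (Fin d) :=
  WithLp.toLp 2 (fun j => c (Sum.inr j))

/-- `h(s(β), α, x)` as a function of the joint parameter `c = (β, α)`. -/
def hJoint (φ : ℝ → ℝ≥0∞) (ν : Measure 𝒳) (p : EuclideanSpace ℝ (Fin d) → 𝒳 → ℝ)
    (s : EuclideanSpace ℝ (Fin m) → EuclideanSpace ℝ (Fin d)) (x : 𝒳)
    (c : EuclideanSpace ℝ (Fin m ⊕ Fin d)) : ℝ :=
  hFun φ ν p (s (betaPart c)) (alphaPart c) x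

/-- `f(s(β), α, x) p_{s(β)}(x)` as a function of the joint parameter `c = (β, α)`. -/
def fpJoint (φ : ℝ → ℝ≥0∞) (p : EuclideanSpace ℝ (Fin d) → 𝒳 → ℝ)
    (s : EuclideanSpace ℝ (Fin m) → EuclideanSpace ℝ (Fin d)) (x : 𝒳)
    (c : EuclideanSpace ℝ (Fin m ⊕ Fin d)) : ℝ :=
  fFun φ p (s (betaPart c)) (alphaPart c) x * p (s (betaPart c)) x

/-- The first order partial derivative of `k` in the `i`-th coordinate. -/
def partialDeriv {ι : Type*} [Fintype ι] [DecidableEq ι] (k : EuclideanSpace ℝ ι → ℝ) (i : ι)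
    (c : EuclideanSpace ℝ ι) : ℝ :=
  fderiv ℝ k c (EuclideanSpace.single i 1)

/-- The matrix `A`: the `P_{θ_T}`-expectation of the Hessian of `h(s(β), α)` in `(β, α)`. -/
def matrixA (φ : ℝ → ℝ≥0∞) (ν : Measure 𝒳) (p : EuclideanSpace ℝ (Fin d) → 𝒳 → ℝ)
    (s : EuclideanSpace ℝ (Fin m) → EuclideanSpace ℝ (Fin d)) (θT : EuclideanSpace ℝ (Fin d))
    (βs : EuclideanSpace ℝ (Fin m)) : Matrix (Fin m ⊕ Fin d) (Fin m ⊕ Fin d) ℝ :=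
  Matrix.of fun i j =>
    ∫ x, partialDeriv (partialDeriv (hJoint φ ν p s x) j) i (joint βs θT) ∂(law ν p θT)

/-- The matrix `F`: the `P_{θ_T}`-expectation of the gradient of `h(s(β), α)` in `(β, α)` times its
transpose. -/
def matrixF (φ : ℝ → ℝ≥0∞) (ν : Measure 𝒳) (p : EuclideanSpace ℝ (Fin d) → 𝒳 → ℝ)
    (s : EuclideanSpace ℝ (Fin m) → EuclideanSpace ℝ (Fin d)) (θT : EuclideanSpace ℝ (Fin d))
    (βs : EuclideanSpace ℝ (Fin m)) : Matrix (Fin m ⊕ Fin d) (Fin m ⊕ Fin d) ℝ :=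
  Matrix.of fun i j =>
    ∫ x, partialDeriv (hJoint φ ν p s x) i (joint βs θT) *
      partialDeriv (hJoint φ ν p s x) j (joint βs θT) ∂(law ν p θT)

/-- The minimum of `D_φ(·, θ_T)` on `Θ₀ = s(B₀)` is attained at `s(β*)`. -/
def CondC1 (φ : ℝ → ℝ≥0∞) (ν : Measure 𝒳) (p : EuclideanSpace ℝ (Fin d) → 𝒳 → ℝ)
    (B₀ : Set (EuclideanSpace ℝ (Fin m)))
    (s : EuclideanSpace ℝ (Fin m) → EuclideanSpace ℝ (Fin d)) (θT : EuclideanSpace ℝ (Fin d))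
    (βs : EuclideanSpace ℝ (Fin m)) : Prop :=
  βs ∈ B₀ ∧ IsMinOn (fun θ => divergence φ ν p θ θT) (s '' B₀) (s βs)

/-- On a neighborhood `N(β*) × N(θ_T)`: the first and second order partial derivatives of
`f(s(β), α, x) p_{s(β)}(x)` exist, are continuous and dominated by a `ν`-integrable function, and
the partial derivatives of `h(s(β), α, x)` up to the third order exist and are continuous, those of
the third order being dominated by a `P_{θ_T}`-integrable function. -/
def CondC2 (φ : ℝ → ℝ≥0∞) (ν : Measure 𝒳) (Θ : Set (EuclideanSpace ℝ (Fin d)))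
    (p : EuclideanSpace ℝ (Fin d) → 𝒳 → ℝ) (B₀ : Set (EuclideanSpace ℝ (Fin m)))
    (s : EuclideanSpace ℝ (Fin m) → EuclideanSpace ℝ (Fin d)) (θT : EuclideanSpace ℝ (Fin d))
    (βs : EuclideanSpace ℝ (Fin m)) : Prop :=
  ∃ (U : Set (EuclideanSpace ℝ (Fin m))) (V : Set (EuclideanSpace ℝ (Fin d)))
    (G H : 𝒳 → ℝ),
    IsOpen U ∧ βs ∈ U ∧ U ⊆ B₀ ∧ IsOpen V ∧ θT ∈ V ∧ V ⊆ Θ ∧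
    Integrable G ν ∧ Integrable H (law ν p θT) ∧
    (∀ᵐ x ∂ν, ∀ β ∈ U, ∀ α ∈ V,
      ContDiffAt ℝ 2 (fpJoint φ p s x) (joint β α) ∧
      ‖iteratedFDeriv ℝ 1 (fpJoint φ p s x) (joint β α)‖ ≤ G x ∧
      ‖iteratedFDeriv ℝ 2 (fpJoint φ p s x) (joint β α)‖ ≤ G x) ∧
    (∀ᵐ x ∂(law ν p θT), ∀ β ∈ U, ∀ α ∈ V,
      ContDiffAt ℝ 3 (hJoint φ ν p s x) (joint β α) ∧
      ‖iteratedFDeriv ℝ 3 (hJoint φ ν p s x) (joint β α)‖ ≤ H x)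

/-- At `(β*, θ_T)` the gradient of `h(s(β), α)` is square integrable and its Hessian is
integrable under `P_{θ_T}`, and the matrix `A` is nonsingular. -/
def CondC3 (φ : ℝ → ℝ≥0∞) (ν : Measure 𝒳) (p : EuclideanSpace ℝ (Fin d) → 𝒳 → ℝ)
    (s : EuclideanSpace ℝ (Fin m) → EuclideanSpace ℝ (Fin d)) (θT : EuclideanSpace ℝ (Fin d))
    (βs : EuclideanSpace ℝ (Fin m)) : Prop :=
  (∀ i, Integrable (fun x => (partialDeriv (hJoint φ ν p s x) i (joint βs θT)) ^ 2)
    (law ν p θT)) ∧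
  (∀ i j, Integrable
    (fun x => partialDeriv (partialDeriv (hJoint φ ν p s x) j) i (joint βs θT)) (law ν p θT)) ∧
  IsUnit (matrixA φ ν p s θT βs).det

/-- `h(s(β*), θ_T)` is square integrable under `P_{θ_T}`. -/
def CondC4 (φ : ℝ → ℝ≥0∞) (ν : Measure 𝒳) (p : EuclideanSpace ℝ (Fin d) → 𝒳 → ℝ)
    (s : EuclideanSpace ℝ (Fin m) → EuclideanSpace ℝ (Fin d)) (θT : EuclideanSpace ℝ (Fin d))
    (βs : EuclideanSpace ℝ (Fin m)) : Prop :=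
  Integrable (fun x => (hFun φ ν p (s βs) θT x) ^ 2) (law ν p θT)

variable {Ω : Type*}

/-- `P_n k = (1/n) ∑_{i < n} k(X_i)`, the integral of `k` under the empirical measure. -/
def empMean (X : ℕ → Ω → 𝒳) (n : ℕ) (ω : Ω) (k : 𝒳 → ℝ) : ℝ :=
  (n : ℝ)⁻¹ * ∑ i ∈ Finset.range n, k (X i ω)

/-- `sup_{α ∈ Θ} P_n h(θ, α)`, the estimate of `D_φ(θ, θ_T)`. -/
def divHat (φ : ℝ → ℝ≥0∞) (ν : Measure 𝒳) (Θ : Set (EuclideanSpace ℝ (Fin d)))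
    (p : EuclideanSpace ℝ (Fin d) → 𝒳 → ℝ) (X : ℕ → Ω → 𝒳) (n : ℕ) (ω : Ω)
    (θ : EuclideanSpace ℝ (Fin d)) : EReal :=
  ⨆ α ∈ Θ, ((empMean X n ω (hFun φ ν p θ α) : ℝ) : EReal)

/-- `inf_{θ ∈ Θ₀} sup_{α ∈ Θ} P_n h(θ, α)`, the estimate of `D_φ(Θ₀, θ_T)`. -/
def divHatFrom (φ : ℝ → ℝ≥0∞) (ν : Measure 𝒳) (Θ Θ₀ : Set (EuclideanSpace ℝ (Fin d)))
    (p : EuclideanSpace ℝ (Fin d) → 𝒳 → ℝ) (X : ℕ → Ω → 𝒳) (n : ℕ) (ω : Ω) : EReal :=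
  ⨅ θ ∈ Θ₀, divHat φ ν Θ p X n ω θ

/-- `α` is a value of the dual estimate at `θ`: it maximizes `P_n h(θ, ·)` over `Θ`. -/
def IsDualEstimate (φ : ℝ → ℝ≥0∞) (ν : Measure 𝒳) (Θ : Set (EuclideanSpace ℝ (Fin d)))
    (p : EuclideanSpace ℝ (Fin d) → 𝒳 → ℝ) (X : ℕ → Ω → 𝒳) (n : ℕ) (ω : Ω)
    (θ α : EuclideanSpace ℝ (Fin d)) : Prop :=
  α ∈ Θ ∧ IsMaxOn (fun a => empMean X n ω (hFun φ ν p θ a)) Θ α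

/-- The min-max estimates exist with probability tending to one and are consistent.
The estimate `α̂_n` is a function of `β`; its existence and its consistency are required at `β̂_n`
and at the points `β` of some neighborhood of `β̂_n`, which may depend on `n` and on the sample. -/
structure CondC5 [MeasurableSpace Ω] (Pr : Measure Ω) (φ : ℝ → ℝ≥0∞) (ν : Measure 𝒳)
    (Θ : Set (EuclideanSpace ℝ (Fin d)))
    (p : EuclideanSpace ℝ (Fin d) → 𝒳 → ℝ) (B₀ : Set (EuclideanSpace ℝ (Fin m)))
    (s : EuclideanSpace ℝ (Fin m) → EuclideanSpace ℝ (Fin d)) (θT : EuclideanSpace ℝ (Fin d))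
    (βs : EuclideanSpace ℝ (Fin m)) (X : ℕ → Ω → 𝒳)
    (βhat : ℕ → Ω → EuclideanSpace ℝ (Fin m))
    (αhat : ℕ → Ω → EuclideanSpace ℝ (Fin m) → EuclideanSpace ℝ (Fin d)) : Prop where
  beta_exists : Tendsto (fun n => Pr {ω | ¬ (βhat n ω ∈ B₀ ∧
    IsMinOn (fun β => divHat φ ν Θ p X n ω (s β)) B₀ (βhat n ω))}) atTop (𝓝 0)
  beta_consistent : TendstoInMeasure Pr βhat atTop (fun _ => βs)
  alpha_exists_consistent : ∀ ε > 0, Tendsto (fun n => Pr {ω | ¬ ∀ᶠ β in 𝓝 (βhat n ω),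
    IsDualEstimate φ ν Θ p X n ω (s β) (αhat n ω β) ∧ ‖αhat n ω β - θT‖ < ε}) atTop (𝓝 0)

end Composite

end PhiDivergence

end

open PhiDivergence

/-! By duality, `(β*, θ_T)` is a saddle point of the mean criterion `(β, α) ↦ P_{θ_T} h(s(β), α)`.
After a change of measure, the mean of `h(θ, α)` is the mean of a tangent line of `φ` touching at
`p_θ / p_α` and evaluated at `p_θ / p_{θ_T}`. Convexity makes it maximal at `α = θ_T`, whatever `θ`,
and the maximum is `D_φ(θ, θ_T)`, which (C.1) minimizes at `β*` (`IsModel.integral_hFun_le`,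
`IsModel.divergence_eq`).

Integrating pointwise Taylor expansions gives the mean criterion a quadratic expansion with cubic
remainder. The saddle property then makes the mean gradient vanish, and with `A` nonsingular the
Hessian is negative definite in the `α`-direction (`expansion_of_saddle`,
`exists_neg_bound_of_saddle`).

The estimate `(β̂, α̂(β̂))` solves a min-max problem, and `α̂` is not known to be continuous in `β`,
so the inner maximum cannot simply be differentiated. Strong concavity in `α`, inherited by the
empirical criterion near `c*`, replaces this: it absorbs the contribution of `α̂(β)` up to `O(‖β -
β̂‖²)` and forces the full gradient to vanish at the estimate (`fderiv_eq_zero_of_saddle`).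

The rest is the method for M-estimators. Linearizing the zero gradient gives `√n (c_n - c*) = -A⁻¹
√n P_n ∇h + o_P(1)`, and the multivariate central limit theorem yields (a). For (b), stationarity
makes the empirical criterion at `c_n` and at `c*` differ by `O(‖c_n - c*‖²)`, negligible after
multiplication by `√n`; only the fluctuation of `P_n h(s(β*), θ_T)` remains. -/

namespace PhiDivergence

/-! ### Taylor estimates for functions with bounded third derivative -/

section Taylor

variable {E : Type*} [NormedAddCommGroup E] [NormedSpace ℝ E] {K : E → ℝ} {W : Set E} {M : ℝ}

/-- `K` is three times continuously differentiable at the points of `W`, its third derivative being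
bounded there by `M`. -/
def BoundedThirdDeriv (K : E → ℝ) (W : Set E) (M : ℝ) : Prop :=
  ∀ z ∈ W, ContDiffAt ℝ 3 K z ∧ ‖iteratedFDeriv ℝ 3 K z‖ ≤ M

theorem BoundedThirdDeriv.hasFDerivAt (hK : BoundedThirdDeriv K W M) {z : E} (hz : z ∈ W) :
    HasFDerivAt K (fderiv ℝ K z) z :=
  ((hK z hz).1.differentiableAt (by norm_num)).hasFDerivAt

theorem contDiffAt_two_fderiv {z : E} (h : ContDiffAt ℝ 3 K z) :
    ContDiffAt ℝ 2 (fderiv ℝ K) z := h.fderiv_right (by norm_num)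

theorem contDiffAt_one_fderiv_fderiv {z : E} (h : ContDiffAt ℝ 3 K z) :
    ContDiffAt ℝ 1 (fderiv ℝ (fderiv ℝ K)) z :=
  (contDiffAt_two_fderiv h).fderiv_right (by norm_num)

theorem BoundedThirdDeriv.hasFDerivAt_fderiv (hK : BoundedThirdDeriv K W M) {z : E} (hz : z ∈ W) :
    HasFDerivAt (fderiv ℝ K) (fderiv ℝ (fderiv ℝ K) z) z :=
  ((contDiffAt_two_fderiv (hK z hz).1).differentiableAt (by norm_num)).hasFDerivAt

theorem BoundedThirdDeriv.symm (hK : BoundedThirdDeriv K W M) {z : E} (hz : z ∈ W) (u v : E) :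
    fderiv ℝ (fderiv ℝ K) z u v = fderiv ℝ (fderiv ℝ K) z v u :=
  ((hK z hz).1.isSymmSndFDerivAt (by simp; norm_num)) u v

set_option maxSynthPendingDepth 3 in
theorem norm_fderiv_fderiv_fderiv (z : E) :
    ‖fderiv ℝ (fderiv ℝ (fderiv ℝ K)) z‖ = ‖iteratedFDeriv ℝ 3 K z‖ := by
  rw [← norm_iteratedFDeriv_fderiv, ← norm_iteratedFDeriv_fderiv, ← norm_iteratedFDeriv_fderiv,
    norm_iteratedFDeriv_zero]

theorem BoundedThirdDeriv.nonneg (hK : BoundedThirdDeriv K W M) {z : E} (hz : z ∈ W) : 0 ≤ M :=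
  (norm_nonneg _).trans (hK z hz).2

set_option maxSynthPendingDepth 3 in
theorem BoundedThirdDeriv.norm_hessian_sub_le (hK : BoundedThirdDeriv K W M) (hW : Convex ℝ W)
    {x y : E} (hx : x ∈ W) (hy : y ∈ W) :
    ‖fderiv ℝ (fderiv ℝ K) y - fderiv ℝ (fderiv ℝ K) x‖ ≤ M * ‖y - x‖ :=
  hW.norm_image_sub_le_of_norm_hasFDerivWithin_le
    (fun z hz => ((contDiffAt_one_fderiv_fderiv (hK z hz).1).differentiableAt
      (by norm_num)).hasFDerivAt.hasFDerivWithinAt)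
    (fun z hz => (norm_fderiv_fderiv_fderiv z).trans_le (hK z hz).2) hx hy

theorem norm_sub_le_of_mem_segment {x y z : E} (hz : z ∈ segment ℝ x y) : ‖z - x‖ ≤ ‖y - x‖ := by
  obtain ⟨a, b, ha, hb, hab, rfl⟩ := hz
  have : a • x + b • y - x = b • (y - x) := by
    rw [show a = 1 - b by linarith]; module
  rw [this, norm_smul, Real.norm_of_nonneg hb]
  exact mul_le_of_le_one_left (norm_nonneg _) (by linarith)

theorem BoundedThirdDeriv.norm_fderiv_sub_le (hK : BoundedThirdDeriv K W M) (hW : Convex ℝ W)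
    {x y : E} (hx : x ∈ W) (hy : y ∈ W) :
    ‖fderiv ℝ K y - fderiv ℝ K x - fderiv ℝ (fderiv ℝ K) x (y - x)‖ ≤ M * ‖y - x‖ ^ 2 := by
  have hsub : segment ℝ x y ⊆ W := hW.segment_subset hx hy
  have := (convex_segment x y).norm_image_sub_le_of_norm_hasFDerivWithin_le'
    (f := fderiv ℝ K) (φ := fderiv ℝ (fderiv ℝ K) x) (C := M * ‖y - x‖)
    (fun z hz => (hK.hasFDerivAt_fderiv (hsub hz)).hasFDerivWithinAt)
    (fun z hz => (hK.norm_hessian_sub_le hW hx (hsub hz)).trans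
      (mul_le_mul_of_nonneg_left (norm_sub_le_of_mem_segment hz) (hK.nonneg hx)))
    (left_mem_segment ℝ x y) (right_mem_segment ℝ x y)
  rwa [mul_assoc, ← sq] at this

/-- The mean value inequality is applied to `K` minus its quadratic Taylor polynomial, on the
segment, where `‖z - x‖ ≤ ‖y - x‖`. This costs the factor `1 / 6` of the sharp remainder, which
plays no role. -/
theorem BoundedThirdDeriv.abs_sub_le (hK : BoundedThirdDeriv K W M) (hW : Convex ℝ W)
    {x y : E} (hx : x ∈ W) (hy : y ∈ W) :
    |K y - K x - fderiv ℝ K x (y - x) - 1 / 2 * fderiv ℝ (fderiv ℝ K) x (y - x) (y - x)| ≤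
      M * ‖y - x‖ ^ 3 := by
  have hsub : segment ℝ x y ⊆ W := hW.segment_subset hx hy
  set Q := fderiv ℝ (fderiv ℝ K) x with hQ
  have hd : ∀ z ∈ segment ℝ x y, HasFDerivWithinAt
      (fun z => K z - fderiv ℝ K x z - 1 / 2 * Q (z - x) (z - x))
      (fderiv ℝ K z - fderiv ℝ K x - Q (z - x)) (segment ℝ x y) z := by
    intro z hz
    have h1 : HasFDerivAt (fun z => Q (z - x) (z - x)) ((2 : ℝ) • Q (z - x)) z := by
      have h0 : HasFDerivAt (fun z : E => z - x) (ContinuousLinearMap.id ℝ E) z :=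
        (hasFDerivAt_id z).sub_const x
      have h2 : HasFDerivAt (fun z : E => Q (z - x)) Q z := by
        have := Q.hasFDerivAt.comp z h0
        rwa [ContinuousLinearMap.comp_id] at this
      refine (h2.clm_apply h0).congr_fderiv ?_
      ext v
      have := hK.symm hx v (z - x)
      simp only [ContinuousLinearMap.comp_id, _root_.add_apply, ContinuousLinearMap.flip_apply,
        _root_.smul_apply, smul_eq_mul]
      rw [hQ, this]; ring
    have h3 := ((hK.hasFDerivAt (hsub hz)).sub (fderiv ℝ K x).hasFDerivAt).sub
      (h1.const_mul (1 / 2))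
    refine (h3.congr_fderiv ?_).hasFDerivWithinAt
    rw [smul_smul]; norm_num
  have := (convex_segment x y).norm_image_sub_le_of_norm_hasFDerivWithin_le
    (C := M * ‖y - x‖ ^ 2) hd
    (fun z hz => (hK.norm_fderiv_sub_le hW hx (hsub hz)).trans
      (mul_le_mul_of_nonneg_left (by gcongr; exact norm_sub_le_of_mem_segment hz) (hK.nonneg hx)))
    (left_mem_segment ℝ x y) (right_mem_segment ℝ x y)
  rw [Real.norm_eq_abs] at this
  calc _ = _ := by
        congr 1; simp only [sub_self, map_zero, map_sub, _root_.sub_apply]; ring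
    _ ≤ _ := this
    _ = _ := by ring

end Taylor

/-! ### The block structure of the joint parameter -/

section Joint

variable {m d : ℕ}

theorem joint_add (b b' : EuclideanSpace ℝ (Fin m)) (a a' : EuclideanSpace ℝ (Fin d)) :
    joint (b + b') (a + a') = joint b a + joint b' a' := by
  ext i; rcases i with i | i <;> simp [joint]

theorem joint_sub (b b' : EuclideanSpace ℝ (Fin m)) (a a' : EuclideanSpace ℝ (Fin d)) :
    joint (b - b') (a - a') = joint b a - joint b' a' := by
  ext i; rcases i with i | i <;> simp [joint]

theorem joint_smul (t : ℝ) (b : EuclideanSpace ℝ (Fin m)) (a : EuclideanSpace ℝ (Fin d)) :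
    joint (t • b) (t • a) = t • joint b a := by
  ext i; rcases i with i | i <;> simp [joint]

@[simp]
theorem joint_zero : joint (0 : EuclideanSpace ℝ (Fin m)) (0 : EuclideanSpace ℝ (Fin d)) = 0 := by
  ext i; rcases i with i | i <;> simp [joint]

@[simp]
theorem betaPart_joint (b : EuclideanSpace ℝ (Fin m)) (a : EuclideanSpace ℝ (Fin d)) :
    betaPart (joint b a) = b := by
  ext i; simp [joint, betaPart]

@[simp]
theorem alphaPart_joint (b : EuclideanSpace ℝ (Fin m)) (a : EuclideanSpace ℝ (Fin d)) :
    alphaPart (joint b a) = a := by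
  ext i; simp [joint, alphaPart]

@[simp]
theorem joint_parts (c : EuclideanSpace ℝ (Fin m ⊕ Fin d)) :
    joint (betaPart c) (alphaPart c) = c := by
  ext i; rcases i with i | i <;> simp [joint, alphaPart, betaPart]

theorem norm_joint_sq (b : EuclideanSpace ℝ (Fin m)) (a : EuclideanSpace ℝ (Fin d)) :
    ‖joint b a‖ ^ 2 = ‖b‖ ^ 2 + ‖a‖ ^ 2 := by
  simp [EuclideanSpace.norm_sq_eq, joint, Fintype.sum_sum_type]

theorem norm_joint_zero_right (b : EuclideanSpace ℝ (Fin m)) :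
    ‖joint b (0 : EuclideanSpace ℝ (Fin d))‖ = ‖b‖ := by
  have := norm_joint_sq b (0 : EuclideanSpace ℝ (Fin d))
  rw [← sq_eq_sq₀ (norm_nonneg _) (norm_nonneg _), this]; simp

theorem norm_joint_zero_left (a : EuclideanSpace ℝ (Fin d)) :
    ‖joint (0 : EuclideanSpace ℝ (Fin m)) a‖ = ‖a‖ := by
  have := norm_joint_sq (0 : EuclideanSpace ℝ (Fin m)) a
  rw [← sq_eq_sq₀ (norm_nonneg _) (norm_nonneg _), this]; simp

theorem joint_eq_add (b : EuclideanSpace ℝ (Fin m)) (a : EuclideanSpace ℝ (Fin d)) :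
    joint b a = joint b 0 + joint 0 a := by
  rw [← joint_add]; simp

theorem norm_joint_le (b : EuclideanSpace ℝ (Fin m)) (a : EuclideanSpace ℝ (Fin d)) :
    ‖joint b a‖ ≤ ‖b‖ + ‖a‖ := by
  rw [joint_eq_add]
  refine (norm_add_le _ _).trans ?_
  rw [norm_joint_zero_right, norm_joint_zero_left]

/-- The embedding of the `β`-block. -/
noncomputable def jointInl (m d : ℕ) :
    EuclideanSpace ℝ (Fin m) →L[ℝ] EuclideanSpace ℝ (Fin m ⊕ Fin d) :=
  LinearMap.toContinuousLinearMap
    { toFun := fun b => joint b 0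
      map_add' := fun b b' => by rw [← joint_add]; simp
      map_smul' := fun t b => by rw [RingHom.id_apply, ← joint_smul]; simp }

/-- The embedding of the `α`-block. -/
noncomputable def jointInr (m d : ℕ) :
    EuclideanSpace ℝ (Fin d) →L[ℝ] EuclideanSpace ℝ (Fin m ⊕ Fin d) :=
  LinearMap.toContinuousLinearMap
    { toFun := fun a => joint 0 a
      map_add' := fun b b' => by rw [← joint_add]; simp
      map_smul' := fun t b => by rw [RingHom.id_apply, ← joint_smul]; simp }

theorem jointInr_apply (a : EuclideanSpace ℝ (Fin d)) : jointInr m d a = joint 0 a := rfl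

theorem joint_eq (b : EuclideanSpace ℝ (Fin m)) (a : EuclideanSpace ℝ (Fin d)) :
    joint b a = jointInl m d b + jointInr m d a := joint_eq_add b a

theorem continuous_joint : Continuous
    (fun z : EuclideanSpace ℝ (Fin m) × EuclideanSpace ℝ (Fin d) => joint z.1 z.2) := by
  simp_rw [joint_eq]; fun_prop

theorem hasFDerivAt_joint_right (b : EuclideanSpace ℝ (Fin m)) (a : EuclideanSpace ℝ (Fin d)) :
    HasFDerivAt (fun a => joint b a) (jointInr m d) a := by
  simp_rw [joint_eq]
  exact (jointInr m d).hasFDerivAt.const_add _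

theorem quad_joint (Q : EuclideanSpace ℝ (Fin m ⊕ Fin d) →L[ℝ]
      EuclideanSpace ℝ (Fin m ⊕ Fin d) →L[ℝ] ℝ) (hQ : ∀ u v, Q u v = Q v u)
    (b : EuclideanSpace ℝ (Fin m)) (a : EuclideanSpace ℝ (Fin d)) :
    Q (joint b a) (joint b a) = Q (joint b 0) (joint b 0) + 2 * Q (joint b 0) (joint 0 a) +
      Q (joint 0 a) (joint 0 a) := by
  rw [joint_eq_add b a]
  simp only [map_add, _root_.add_apply]
  rw [hQ (joint 0 a) (joint b 0)]; ring

end Joint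

/-! ### Saddle points -/

section Saddle

variable {m d : ℕ}

/-- A smooth `K` which is locally strongly concave in the `α`-direction is stationary at
`(b₀, a₀)` if `a₀` maximizes `K (b₀, ·)` locally and if `K (b₀, a₀)` does not exceed the value
of `K` at a suitable `(b, a)` for each `b` near `b₀`. -/
theorem fderiv_eq_zero_of_saddle {K : EuclideanSpace ℝ (Fin m ⊕ Fin d) → ℝ}
    {W : Set (EuclideanSpace ℝ (Fin m ⊕ Fin d))} {M κ ε : ℝ}
    (hK : BoundedThirdDeriv K W M) (hW : Convex ℝ W)
    {b₀ : EuclideanSpace ℝ (Fin m)} {a₀ : EuclideanSpace ℝ (Fin d)} (h0 : joint b₀ a₀ ∈ W)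
    (hκ : 0 < κ)
    (hneg : ∀ a, fderiv ℝ (fderiv ℝ K) (joint b₀ a₀) (joint 0 a) (joint 0 a) ≤ -κ * ‖a‖ ^ 2)
    (hε : M * ε ≤ κ / 8) (hmax : IsLocalMax (fun a => K (joint b₀ a)) a₀)
    (hmin : ∀ᶠ b in 𝓝 b₀, ∃ a, joint b a ∈ W ∧ ‖joint b a - joint b₀ a₀‖ ≤ ε ∧
      K (joint b₀ a₀) ≤ K (joint b a)) :
    fderiv ℝ K (joint b₀ a₀) = 0 := by
  have hM := hK.nonneg h0
  set L := fderiv ℝ K (joint b₀ a₀) with hL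
  set Q := fderiv ℝ (fderiv ℝ K) (joint b₀ a₀) with hQ
  have hLα : ∀ a, L (joint 0 a) = 0 := by
    have h1 := (hK.hasFDerivAt h0).comp a₀ (hasFDerivAt_joint_right b₀ a₀)
    have h2 := hmax.hasFDerivAt_eq_zero h1
    intro a
    exact DFunLike.congr_fun h2 a
  set q := ‖Q‖ with hq
  -- The three terms bound the `β`-block of half the Hessian, the part of the cross term left by
  -- Young's inequality, and the `β`-share of the cubic remainder.
  set C := q / 2 + q ^ 2 / κ + κ / 8 with hC
  -- The coefficients of `‖a - a₀‖ ^ 2` sum to `-κ/2 + κ/4 + κ/8 < 0`, so `a` drops out and its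
  -- dependence on `b` is irrelevant. The right side is then locally minimal at `b₀`, where its
  -- derivative is the `β`-part of `L`.
  have hquad : ∀ᶠ b in 𝓝 b₀, 0 ≤ L (joint (b - b₀) 0) + C * ‖b - b₀‖ ^ 2 := by
    filter_upwards [hmin] with b ⟨a, hbW, hbε, hb⟩
    have ht := (abs_le.1 (hK.abs_sub_le hW h0 hbW)).2
    rw [← joint_sub] at ht hbε
    rw [← hL, ← hQ, quad_joint Q (hK.symm h0), joint_eq_add (b - b₀), map_add, hLα,
      ← joint_eq_add (b - b₀)] at ht
    have hn := norm_joint_sq (b - b₀) (a - a₀)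
    have hcube : M * ‖joint (b - b₀) (a - a₀)‖ ^ 3 ≤
        κ / 8 * (‖b - b₀‖ ^ 2 + ‖a - a₀‖ ^ 2) := by
      rw [← hn]
      calc M * ‖joint (b - b₀) (a - a₀)‖ ^ 3
          = (M * ‖joint (b - b₀) (a - a₀)‖) * ‖joint (b - b₀) (a - a₀)‖ ^ 2 := by ring
        _ ≤ κ / 8 * ‖joint (b - b₀) (a - a₀)‖ ^ 2 := by
          gcongr
          exact (mul_le_mul_of_nonneg_left hbε hM).trans hε
    have h1 : Q (joint (b - b₀) 0) (joint (b - b₀) 0) ≤ q * ‖b - b₀‖ ^ 2 := by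
      refine (le_abs_self _).trans ((Q.le_opNorm₂ _ _).trans_eq ?_)
      rw [norm_joint_zero_right]; ring
    have h2 : Q (joint (b - b₀) 0) (joint 0 (a - a₀)) ≤ q * ‖b - b₀‖ * ‖a - a₀‖ := by
      refine (le_abs_self _).trans ((Q.le_opNorm₂ _ _).trans_eq ?_)
      rw [norm_joint_zero_right, norm_joint_zero_left]
    have h3 := hneg (a - a₀)
    have h4 : q * ‖b - b₀‖ * ‖a - a₀‖ ≤ κ / 4 * ‖a - a₀‖ ^ 2 + q ^ 2 / κ * ‖b - b₀‖ ^ 2 := by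
      have : κ / 4 * ‖a - a₀‖ ^ 2 + q ^ 2 / κ * ‖b - b₀‖ ^ 2 - q * ‖b - b₀‖ * ‖a - a₀‖ =
          (κ / 2 * ‖a - a₀‖ - q * ‖b - b₀‖) ^ 2 / κ := by field_simp; ring
      have h5 : 0 ≤ (κ / 2 * ‖a - a₀‖ - q * ‖b - b₀‖) ^ 2 / κ := by positivity
      linarith
    have h6 : 0 ≤ κ * ‖a - a₀‖ ^ 2 := by positivity
    rw [hC]
    linarith
  have hfd : HasFDerivAt (fun b : EuclideanSpace ℝ (Fin m) =>
      L (joint (b - b₀) 0) + C * ‖b - b₀‖ ^ 2) (L.comp (jointInl m d)) b₀ := by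
    have h1 : HasFDerivAt (fun b : EuclideanSpace ℝ (Fin m) => b - b₀)
        (ContinuousLinearMap.id ℝ _) b₀ := (hasFDerivAt_id b₀).sub_const b₀
    have h2 := (L.comp (jointInl m d)).hasFDerivAt.comp b₀ h1
    refine (h2.add (h1.norm_sq.const_mul C)).congr_fderiv ?_
    ext v; simp
  have hmin' : IsLocalMin (fun b : EuclideanSpace ℝ (Fin m) =>
      L (joint (b - b₀) 0) + C * ‖b - b₀‖ ^ 2) b₀ := by
    filter_upwards [hquad] with b hb
    simpa using hb
  have h2 := hmin'.hasFDerivAt_eq_zero hfd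
  ext w
  rw [← joint_parts w, joint_eq_add, map_add, hLα, add_zero]
  exact DFunLike.congr_fun h2 (betaPart w)

theorem linear_coeff_nonpos {x y C : ℝ}
    (h : ∀ᶠ t in 𝓝 (0 : ℝ), t * x + t ^ 2 * y ≤ C * |t| ^ 3) : x ≤ 0 := by
  have h1 : Tendsto (fun t : ℝ => x + t * y - C * t ^ 2) (𝓝[>] 0) (𝓝 x) := by
    have : Continuous (fun t : ℝ => x + t * y - C * t ^ 2) := by fun_prop
    simpa using (this.tendsto 0).mono_left nhdsWithin_le_nhds
  refine le_of_tendsto h1 ?_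
  filter_upwards [h.filter_mono nhdsWithin_le_nhds, self_mem_nhdsWithin] with t ht ht0
  rw [mem_Ioi] at ht0
  rw [abs_of_pos ht0] at ht
  have : t * (x + t * y - C * t ^ 2) ≤ 0 := by linarith
  exact nonpos_of_mul_nonpos_right this ht0

/-- A quadratic polynomial that is locally at most of third order near its root `0`. -/
theorem quadratic_coeffs {x y C : ℝ}
    (h : ∀ᶠ t in 𝓝 (0 : ℝ), t * x + t ^ 2 * y ≤ C * |t| ^ 3) : x = 0 ∧ y ≤ 0 := by
  have hx : x = 0 := by
    refine le_antisymm (linear_coeff_nonpos h) ?_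
    have h' : Tendsto (fun t : ℝ => -t) (𝓝 0) (𝓝 0) := by
      simpa using (continuous_neg (G := ℝ)).tendsto 0
    have := linear_coeff_nonpos (x := -x) (y := y) (C := C) (by
      filter_upwards [h'.eventually h] with t ht
      simpa using ht)
    linarith
  refine ⟨hx, ?_⟩
  subst hx
  have h1 : Tendsto (fun t : ℝ => y - C * t) (𝓝[>] 0) (𝓝 y) := by
    have : Continuous (fun t : ℝ => y - C * t) := by fun_prop
    simpa using (this.tendsto 0).mono_left nhdsWithin_le_nhds
  refine le_of_tendsto h1 ?_
  filter_upwards [h.filter_mono nhdsWithin_le_nhds, self_mem_nhdsWithin] with t ht ht0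
  rw [mem_Ioi] at ht0
  rw [abs_of_pos ht0] at ht
  have : t ^ 2 * (y - C * t) ≤ 0 := by linarith
  exact nonpos_of_mul_nonpos_right this (by positivity)

theorem eq_zero_of_forall_mul_add_nonpos {x y : ℝ} (h : ∀ t : ℝ, t * x + y ≤ 0) : x = 0 := by
  by_contra hx
  have := h ((1 - y) / x)
  rw [div_mul_cancel₀ _ hx] at this
  linarith

/-- The second order expansion at a saddle point. -/
theorem expansion_of_saddle {F : EuclideanSpace ℝ (Fin m ⊕ Fin d) → ℝ}
    {L : EuclideanSpace ℝ (Fin m ⊕ Fin d) →L[ℝ] ℝ}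
    {Q : EuclideanSpace ℝ (Fin m ⊕ Fin d) →L[ℝ] EuclideanSpace ℝ (Fin m ⊕ Fin d) →L[ℝ] ℝ}
    {M r : ℝ} (hr : 0 < r)
    (hexp : ∀ w, ‖w‖ < r → |F w - F 0 - L w - 1 / 2 * Q w w| ≤ M * ‖w‖ ^ 3)
    (hα : ∀ b a, ‖joint b a‖ < r → F (joint b a) ≤ F (joint b 0))
    (hβ : ∀ b, ‖b‖ < r → F 0 ≤ F (joint b 0)) :
    L = 0 ∧ ∀ b a, Q (joint b a) (joint b a) ≤ Q (joint b 0) (joint b 0) := by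
  have hsmall : ∀ w : EuclideanSpace ℝ (Fin m ⊕ Fin d), ∀ᶠ t in 𝓝 (0 : ℝ), ‖t • w‖ < r := by
    intro w
    have : Continuous (fun t : ℝ => ‖t • w‖) := by fun_prop
    have h := this.tendsto 0
    simp only [zero_smul, norm_zero] at h
    exact h.eventually_lt_const hr
  have hline : ∀ w (t : ℝ), ‖t • w‖ < r →
      |F (t • w) - F 0 - t * L w - t ^ 2 * (1 / 2 * Q w w)| ≤ M * ‖w‖ ^ 3 * |t| ^ 3 := by
    intro w t ht
    have := hexp (t • w) ht
    rw [norm_smul, Real.norm_eq_abs] at this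
    simp only [map_smul, _root_.smul_apply, smul_eq_mul] at this
    calc _ = _ := by congr 1; ring
      _ ≤ _ := this
      _ = _ := by ring
  have hb : ∀ b, L (joint b 0) = 0 := by
    intro b
    have := (quadratic_coeffs (x := -L (joint b 0)) (y := -(1 / 2 * Q (joint b 0) (joint b 0)))
      (C := M * ‖joint b (0 : EuclideanSpace ℝ (Fin d))‖ ^ 3) (by
        filter_upwards [hsmall (joint b 0)] with t ht
        have h1 := (abs_le.1 (hline _ t ht)).2
        rw [← joint_smul, smul_zero] at ht h1
        have h2 := hβ (t • b) (by rwa [norm_joint_zero_right] at ht)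
        linarith)).1
    linarith
  -- The expansions at `t (b, a)` and `t (b, 0)` are subtracted. The maximum over `a` sits at `0`
  -- for every `b`, not only for `b = 0`, so the second order terms can be compared too.
  have hba : ∀ b a, L (joint b a) = 0 ∧
      Q (joint b a) (joint b a) ≤ Q (joint b 0) (joint b 0) := by
    intro b a
    have := quadratic_coeffs (x := L (joint b a))
      (y := 1 / 2 * Q (joint b a) (joint b a) - 1 / 2 * Q (joint b 0) (joint b 0))
      (C := M * ‖joint b a‖ ^ 3 + M * ‖joint b (0 : EuclideanSpace ℝ (Fin d))‖ ^ 3) (by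
        filter_upwards [hsmall (joint b a), hsmall (joint b 0)] with t ht ht'
        have h1 := (abs_le.1 (hline _ t ht)).1
        have h2 := (abs_le.1 (hline _ t ht')).2
        rw [← joint_smul] at ht h1
        rw [hb, ← joint_smul, smul_zero] at h2
        have h3 := hα (t • b) (t • a) ht
        linarith)
    exact ⟨this.1, by linarith [this.2]⟩
  refine ⟨?_, fun b a => (hba b a).2⟩
  ext w
  rw [← joint_parts w]
  exact (hba _ _).1

/-- At a nondegenerate saddle point the Hessian is negative definite in the `α`-direction. -/
theorem exists_neg_bound_of_saddle
    {Q : EuclideanSpace ℝ (Fin m ⊕ Fin d) →L[ℝ] EuclideanSpace ℝ (Fin m ⊕ Fin d) →L[ℝ] ℝ}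
    (hsymm : ∀ u v, Q u v = Q v u) (hnd : ∀ w, (∀ v, Q w v = 0) → w = 0)
    (hQ : ∀ b a, Q (joint b a) (joint b a) ≤ Q (joint b 0) (joint b 0)) :
    ∃ κ > 0, ∀ a, Q (joint 0 a) (joint 0 a) ≤ -κ * ‖a‖ ^ 2 := by
  -- Replacing `b` by `t • b` leaves an affine function of `t` that is nowhere positive, so its
  -- slope vanishes.
  have hcross : ∀ b a, Q (joint b 0) (joint 0 a) = 0 := by
    intro b a
    have : 2 * Q (joint b 0) (joint 0 a) = 0 := by
      refine eq_zero_of_forall_mul_add_nonpos (y := Q (joint 0 a) (joint 0 a)) fun t => ?_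
      have h := hQ (t • b) a
      have h1 : joint (t • b) (0 : EuclideanSpace ℝ (Fin d)) = t • joint b 0 := by
        rw [← joint_smul, smul_zero]
      rw [quad_joint Q hsymm, h1] at h
      simp only [map_smul, _root_.smul_apply, smul_eq_mul] at h
      linarith
    linarith
  have hnonpos : ∀ a, Q (joint 0 a) (joint 0 a) ≤ 0 := by
    intro a
    simpa using hQ 0 a
  have hneg : ∀ a, a ≠ 0 → Q (joint 0 a) (joint 0 a) < 0 := by
    intro a ha
    refine lt_of_le_of_ne (hnonpos a) fun h0 => ha ?_
    -- An isotropic vector of a semidefinite form lies in its kernel; as the cross block vanishes,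
    -- `joint 0 a` would then lie in the kernel of all of `Q`.
    have h1 : ∀ a', Q (joint 0 a) (joint 0 a') = 0 := by
      intro a'
      have : 2 * Q (joint 0 a) (joint 0 a') = 0 := by
        refine eq_zero_of_forall_mul_add_nonpos (y := Q (joint 0 a') (joint 0 a')) fun t => ?_
        have h := hnonpos (t • a + a')
        have h2 : joint (0 : EuclideanSpace ℝ (Fin m)) (t • a + a') =
            t • joint 0 a + joint 0 a' := by
          rw [← joint_smul, ← joint_add, smul_zero, add_zero]
        rw [h2] at h
        simp only [map_smul, map_add, _root_.add_apply, _root_.smul_apply, smul_eq_mul, h0,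
          hsymm (joint 0 a') (joint 0 a)] at h
        linarith
      linarith
    have h2 : joint (0 : EuclideanSpace ℝ (Fin m)) a = 0 := by
      refine hnd _ fun v => ?_
      rw [← joint_parts v, joint_eq_add (betaPart v) (alphaPart v), map_add, h1, add_zero, hsymm, hcross]
    rw [← alphaPart_joint (0 : EuclideanSpace ℝ (Fin m)) a, h2]
    ext i; simp [alphaPart]
  -- The sphere is empty exactly when `d = 0`, and then any `κ` works; otherwise compactness gives a
  -- uniform bound.
  rcases (Metric.sphere (0 : EuclideanSpace ℝ (Fin d)) 1).eq_empty_or_nonempty with he | hne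
  · refine ⟨1, one_pos, fun a => ?_⟩
    have : a = 0 := by
      by_contra ha
      have h1 : ‖a‖⁻¹ • a ∈ Metric.sphere (0 : EuclideanSpace ℝ (Fin d)) 1 := by
        simp [norm_smul, ha]
      rw [he] at h1
      exact h1
    subst this
    simp
  · have hcont : Continuous (fun a : EuclideanSpace ℝ (Fin d) =>
        Q (jointInr m d a) (jointInr m d a)) := by fun_prop
    obtain ⟨a₁, ha₁, hmax⟩ := (isCompact_sphere (0 : EuclideanSpace ℝ (Fin d)) 1).exists_isMaxOn
      hne hcont.continuousOn
    have ha₁0 : a₁ ≠ 0 := by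
      rintro rfl
      simp at ha₁
    refine ⟨-Q (joint 0 a₁) (joint 0 a₁), by linarith [hneg a₁ ha₁0], fun a => ?_⟩
    rcases eq_or_ne a 0 with rfl | ha
    · simp
    have h1 : ‖a‖⁻¹ • a ∈ Metric.sphere (0 : EuclideanSpace ℝ (Fin d)) 1 := by
      simp [norm_smul, ha]
    have h2 := hmax h1
    simp only [mem_ofPred_eq, map_smul, _root_.smul_apply, smul_eq_mul] at h2
    simp only [jointInr_apply] at h2
    have hpos : 0 < ‖a‖ := norm_pos_iff.2 ha
    rw [neg_neg]
    calc Q (joint 0 a) (joint 0 a)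
        = ‖a‖⁻¹ * (‖a‖⁻¹ * Q (joint 0 a) (joint 0 a)) * ‖a‖ ^ 2 := by field_simp
      _ ≤ _ := by gcongr

end Saddle

/-! ### Events whose probability tends to one -/

section HighProbability

variable {Ω : Type*} [MeasurableSpace Ω] {Pr : Measure Ω}

/-- The property `S n` holds with probability tending to one. -/
def HighProb (Pr : Measure Ω) (S : ℕ → Ω → Prop) : Prop :=
  Tendsto (fun n => Pr {ω | ¬ S n ω}) atTop (𝓝 0)

theorem HighProb.and {S T : ℕ → Ω → Prop} (hS : HighProb Pr S) (hT : HighProb Pr T) :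
    HighProb Pr (fun n ω => S n ω ∧ T n ω) := by
  have h := Tendsto.add hS hT
  rw [add_zero] at h
  refine tendsto_of_tendsto_of_tendsto_of_le_of_le tendsto_const_nhds h (fun _ => zero_le)
    fun n => ?_
  refine (measure_mono fun ω hω => ?_).trans (measure_union_le _ _)
  by_contra hc
  simp only [mem_union, mem_ofPred_eq, not_or, not_not] at hc
  exact hω hc

theorem HighProb.mono {S T : ℕ → Ω → Prop} (hS : HighProb Pr S) (h : ∀ n ω, S n ω → T n ω) :
    HighProb Pr T :=
  tendsto_of_tendsto_of_tendsto_of_le_of_le tendsto_const_nhds hS (fun _ => zero_le)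
    fun n => measure_mono fun ω hω hs => hω (h n ω hs)

theorem HighProb.of_ae {S : ℕ → Ω → Prop} (h : ∀ n, ∀ᵐ ω ∂Pr, S n ω) : HighProb Pr S := by
  have : (fun n => Pr {ω | ¬ S n ω}) = fun _ => 0 := funext fun n => ae_iff.1 (h n)
  rw [HighProb, this]
  exact tendsto_const_nhds

theorem highProb_norm_sub_lt {E : Type*} [SeminormedAddCommGroup E] {X : ℕ → Ω → E} {x : E}
    (h : TendstoInMeasure Pr X atTop (fun _ => x)) {ε : ℝ} (hε : 0 < ε) :
    HighProb Pr (fun n ω => ‖X n ω - x‖ < ε) := by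
  simpa [HighProb, not_lt] using tendstoInMeasure_iff_norm.1 h ε hε

/-- Tightness of the limit law passes to the sequence by the portmanteau theorem for closed sets;
the radius `r + 1` puts a closed set inside the open tail `r < ‖y‖`. -/
theorem exists_norm_bound_of_tendstoInDistribution {E : Type*} [NormedAddCommGroup E]
    [ProperSpace E] [MeasurableSpace E] [BorelSpace E] [IsProbabilityMeasure Pr]
    {Y : ℕ → Ω → E} {μ : Measure E} [IsProbabilityMeasure μ]
    (hY : TendstoInDistribution Y atTop id (fun _ => Pr) μ) {δ : ℝ≥0∞} (hδ : 0 < δ) :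
    ∃ R : ℝ, 0 < R ∧ ∀ᶠ n in atTop, Pr {ω | R ≤ ‖Y n ω‖} ≤ δ := by
  have : SecondCountableTopology E := inferInstance
  have hμ := tendsto_measure_norm_gt_of_isTightMeasureSet (S := {μ}) isTightMeasureSet_singleton
  simp only [iSup_singleton] at hμ
  obtain ⟨r, hr, hr0⟩ := ((hμ.eventually_lt_const hδ).and (eventually_gt_atTop 0)).exists
  refine ⟨r + 1, by linarith, ?_⟩
  have hF : IsClosed {y : E | r + 1 ≤ ‖y‖} := isClosed_le continuous_const continuous_norm
  have h1 := ProbabilityMeasure.limsup_measure_closed_le_of_tendsto hY.tendsto hF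
  have h2 : limsup (fun n => (Pr.map (Y n)) {y : E | r + 1 ≤ ‖y‖}) atTop < δ := by
    refine lt_of_le_of_lt h1 (lt_of_le_of_lt ?_ hr)
    simp only [ProbabilityMeasure.coe_mk, Measure.map_id]
    exact measure_mono fun y (hy : r + 1 ≤ ‖y‖) => show r < ‖y‖ by linarith
  filter_upwards [eventually_lt_of_limsup_lt h2] with n hn
  rw [Measure.map_apply_of_aemeasurable (hY.forall_aemeasurable n) hF.measurableSet] at hn
  exact hn.le

/-- The rule `o_P(1) · O_P(1) = o_P(1)`; `T` is bounded in probability because it converges in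
distribution. -/
theorem tendstoInMeasure_zero_of_norm_le_mul {E F : Type*} [NormedAddCommGroup E]
    [ProperSpace E] [MeasurableSpace E] [BorelSpace E] [SeminormedAddCommGroup F]
    [IsProbabilityMeasure Pr]
    {T : ℕ → Ω → E} {μ : Measure E} [IsProbabilityMeasure μ]
    (hT : TendstoInDistribution T atTop id (fun _ => Pr) μ) {D : ℕ → Ω → F} {η : ℕ → Ω → ℝ}
    (hη : ∀ ε > 0, HighProb Pr (fun n ω => η n ω < ε))
    (h : HighProb Pr (fun n ω => ‖D n ω‖ ≤ η n ω * ‖T n ω‖)) :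
    TendstoInMeasure Pr D atTop 0 := by
  rw [tendstoInMeasure_iff_norm]
  intro ε hε
  rw [ENNReal.tendsto_nhds_zero]
  intro δ hδ
  have hδ2 : 0 < δ / 2 := ENNReal.half_pos hδ.ne'
  obtain ⟨R, hR0, hR⟩ := exists_norm_bound_of_tendstoInDistribution hT hδ2
  have h1 := ENNReal.tendsto_nhds_zero.1 ((hη (ε / R) (by positivity)).and h) _ hδ2
  filter_upwards [hR, h1] with n hn1 hn2
  refine (measure_mono fun ω hω => ?_).trans
    ((measure_union_le _ _).trans ((add_le_add hn1 hn2).trans_eq (ENNReal.add_halves δ)))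
  by_contra hc
  simp only [mem_union, mem_ofPred_eq, not_or, not_not, not_le] at hc
  obtain ⟨hc1, hc2, hc3⟩ := hc
  simp only [mem_ofPred_eq, Pi.zero_apply, sub_zero] at hω
  have h2 : η n ω * ‖T n ω‖ < ε := by
    rcases le_or_gt (η n ω) 0 with h0 | h0
    · exact (mul_nonpos_of_nonpos_of_nonneg h0 (norm_nonneg _)).trans_lt hε
    · calc η n ω * ‖T n ω‖ < ε / R * R := mul_lt_mul'' hc2 hc1 h0.le (norm_nonneg _)
        _ = ε := by field_simp
  linarith

/-- A form of Slutsky's lemma in which the error is relative to `Z`, whose tightness is not known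
beforehand. Once `η < 1 / 2`, the triangle inequality gives `‖Z‖ ≤ 2 ‖Y‖`, and `Y` is tight. -/
theorem tendstoInDistribution_of_norm_sub_le_mul {E : Type*} [NormedAddCommGroup E]
    [ProperSpace E] [MeasurableSpace E] [BorelSpace E]
    [IsProbabilityMeasure Pr] {Y Z : ℕ → Ω → E} {μ : Measure E} [IsProbabilityMeasure μ]
    (hY : TendstoInDistribution Y atTop id (fun _ => Pr) μ) (hZ : ∀ n, AEMeasurable (Z n) Pr)
    {η : ℕ → Ω → ℝ} (hη : ∀ ε > 0, HighProb Pr (fun n ω => η n ω < ε))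
    (h : HighProb Pr (fun n ω => ‖Z n ω - Y n ω‖ ≤ η n ω * ‖Z n ω‖)) :
    TendstoInDistribution Z atTop id (fun _ => Pr) μ := by
  have : SecondCountableTopology E := inferInstance
  refine tendstoInDistribution_of_tendstoInMeasure_sub Z id hY ?_ hZ
  refine tendstoInMeasure_zero_of_norm_le_mul hY 
    (η := fun n ω => 2 * max (η n ω) 0)
    (fun ε hε => (hη (ε / 2) (by positivity)).mono fun n ω hω => ?_)
    ((h.and (hη (1 / 2) (by norm_num))).mono fun n ω hω => ?_)
  · rcases max_cases (η n ω) 0 with h1 | h1 <;> linarith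
  · obtain ⟨h1, h2⟩ := hω
    have h3 : ‖Z n ω‖ ≤ ‖Z n ω - Y n ω‖ + ‖Y n ω‖ := by
      simpa using norm_add_le (Z n ω - Y n ω) (Y n ω)
    have h4 : η n ω * ‖Z n ω‖ ≤ 1 / 2 * ‖Z n ω‖ := by gcongr
    have h5 : ‖Z n ω‖ ≤ 2 * ‖Y n ω‖ := by linarith
    calc ‖Z n ω - Y n ω‖ ≤ η n ω * ‖Z n ω‖ := h1
      _ ≤ max (η n ω) 0 * ‖Z n ω‖ := by gcongr; exact le_max_left _ _
      _ ≤ max (η n ω) 0 * (2 * ‖Y n ω‖) := by gcongr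
      _ = _ := by ring

end HighProbability

/-! ### Limit theorems for independent samples -/

section Sample

variable {𝒳 : Type*} [MeasurableSpace 𝒳] {Ω : Type*} [MeasurableSpace Ω] {Pr : Measure Ω}
  {P : Measure 𝒳} {X : ℕ → Ω → 𝒳}

theorem identDistrib_comp {B : Type*} [MeasurableSpace B] (hX : ∀ i, HasLaw (X i) P Pr)
    {Ψ : 𝒳 → B} (hΨ : AEMeasurable Ψ P) (i : ℕ) :
    IdentDistrib (fun ω => Ψ (X i ω)) (fun ω => Ψ (X 0 ω)) Pr Pr :=
  ((hX i).identDistrib (hX 0)).comp_of_aemeasurable (by rwa [(hX i).map_eq])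

theorem iIndepFun_comp_sample {B : Type*} [MeasurableSpace B] (hX : ∀ i, HasLaw (X i) P Pr)
    (hind : iIndepFun X Pr) {Ψ : 𝒳 → B} (hΨ : AEMeasurable Ψ P) :
    iIndepFun (fun i ω => Ψ (X i ω)) Pr :=
  hind.comp₀ (fun _ => Ψ) (fun i => (hX i).aemeasurable) (fun i => by rwa [(hX i).map_eq])

theorem ae_sample (hX : ∀ i, HasLaw (X i) P Pr) {S : 𝒳 → Prop} (hS : ∀ᵐ x ∂P, S x) :
    ∀ᵐ ω ∂Pr, ∀ i, S (X i ω) := by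
  rw [ae_all_iff]
  intro i
  exact ae_of_ae_map (hX i).aemeasurable (by rwa [(hX i).map_eq])

theorem tendsto_sampleMean [IsProbabilityMeasure Pr] {B : Type*} [NormedAddCommGroup B] [NormedSpace ℝ B] [CompleteSpace B]
    (hX : ∀ i, HasLaw (X i) P Pr) (hind : iIndepFun X Pr) {Ψ : 𝒳 → B} (hΨ : Integrable Ψ P) :
    ∀ᵐ ω ∂Pr, Tendsto (fun n : ℕ => (n : ℝ)⁻¹ • ∑ i ∈ Finset.range n, Ψ (X i ω)) atTop
      (𝓝 (∫ x, Ψ x ∂P)) := by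
  borelize B
  have hm := hΨ.aestronglyMeasurable.aemeasurable
  have h := strong_law_ae (μ := Pr) (fun i ω => Ψ (X i ω))
    (by
      have := hΨ
      rw [← (hX 0).map_eq] at this
      exact this.comp_aemeasurable (hX 0).aemeasurable)
    (fun i j hij => (iIndepFun_comp_sample hX hind hm).indepFun hij) (identDistrib_comp hX hm)
  rwa [← (hX 0).integral_comp hΨ.aestronglyMeasurable]

theorem highProb_sampleMean [IsProbabilityMeasure Pr] {B : Type*} [NormedAddCommGroup B] [NormedSpace ℝ B] [CompleteSpace B]
    (hX : ∀ i, HasLaw (X i) P Pr) (hind : iIndepFun X Pr) {Ψ : 𝒳 → B} (hΨ : Integrable Ψ P)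
    {ε : ℝ} (hε : 0 < ε) :
    HighProb Pr (fun n ω =>
      ‖(n : ℝ)⁻¹ • ∑ i ∈ Finset.range n, Ψ (X i ω) - ∫ x, Ψ x ∂P‖ < ε) := by
  refine highProb_norm_sub_lt
    (X := fun (n : ℕ) ω => (n : ℝ)⁻¹ • ∑ i ∈ Finset.range n, Ψ (X i ω))
    (tendstoInMeasure_of_tendsto_ae (fun n => ?_) (tendsto_sampleMean hX hind hΨ)) hε
  refine AEStronglyMeasurable.const_smul (Finset.aestronglyMeasurable_fun_sum _ fun i _ => ?_) _
  have := hΨ.aestronglyMeasurable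
  rw [← (hX i).map_eq] at this
  exact this.comp_aemeasurable (hX i).aemeasurable

/-- The one-dimensional central limit theorem for the function `Ψ` of an independent sample. -/
theorem clt_sample [IsProbabilityMeasure Pr] (hX : ∀ i, HasLaw (X i) P Pr) (hind : iIndepFun X Pr) {Ψ : 𝒳 → ℝ}
    (hΨ : MemLp Ψ 2 P) :
    TendstoInDistribution
      (fun (n : ℕ) ω => (√n)⁻¹ * (∑ i ∈ Finset.range n, Ψ (X i ω) - n * ∫ x, Ψ x ∂P)) atTop id
      (fun _ => Pr)
      (gaussianReal 0 (Real.toNNReal (∫ x, Ψ x ^ 2 ∂P - (∫ x, Ψ x ∂P) ^ 2))) := by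
  have : IsProbabilityMeasure P := (hX 0).isProbabilityMeasure_iff.1 inferInstance
  have hm := hΨ.aestronglyMeasurable.aemeasurable
  have hmean : ∫ ω, Ψ (X 0 ω) ∂Pr = ∫ x, Ψ x ∂P :=
    (hX 0).integral_comp hΨ.aestronglyMeasurable
  have hL : MemLp (fun ω => Ψ (X 0 ω)) 2 Pr := by
    have := hΨ
    rw [← (hX 0).map_eq] at this
    exact this.comp_of_map (hX 0).aemeasurable
  have hvar : Var[fun ω => Ψ (X 0 ω); Pr] = ∫ x, Ψ x ^ 2 ∂P - (∫ x, Ψ x ∂P) ^ 2 := by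
    rw [variance_eq_sub hL, hmean]
    congr 1
    exact (hX 0).integral_comp (f := fun x => Ψ x ^ 2) (hΨ.aestronglyMeasurable.pow 2)
  have h := tendstoInDistribution_inv_sqrt_mul_sum_sub (X := fun i ω => Ψ (X i ω)) HasLaw.id hL
    (iIndepFun_comp_sample hX hind hm) (identDistrib_comp hX hm)
  rwa [hmean, hvar] at h

/-- The Cramér–Wold device for characteristic functions: it reduces the multivariate limit theorem
to the real one. -/
theorem charFun_map_eq_charFun_map_inner {ι : Type*} [Fintype ι] {Z : Ω → EuclideanSpace ℝ ι}
    (hZ : AEMeasurable Z Pr) (t : EuclideanSpace ℝ ι) :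
    charFun (Pr.map Z) t = charFun (Pr.map (fun ω => inner ℝ (Z ω) t)) 1 := by
  rw [charFun_apply, charFun_apply_real, integral_map hZ (by fun_prop),
    integral_map (by fun_prop) (by fun_prop)]
  simp

/-- Serves twice: it shows that `S` is positive semidefinite, and it identifies the limit variance
in each direction. -/
theorem posSemidef_secondMoment {ι : Type*} [Fintype ι] {Ψ : 𝒳 → EuclideanSpace ℝ ι}
    (hΨ : ∀ i, MemLp (fun x => Ψ x i) 2 P) {S : Matrix ι ι ℝ}
    (hS : ∀ i j, ∫ x, Ψ x i * Ψ x j ∂P = S i j) (t : EuclideanSpace ℝ ι) :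
    ∫ x, (inner ℝ (Ψ x) t) ^ 2 ∂P = t.ofLp ⬝ᵥ S.mulVec t.ofLp := by
  have hint : ∀ i j, Integrable (fun x => Ψ x i * Ψ x j) P := fun i j =>
    (hΨ i).integrable_mul (hΨ j)
  have h1 : ∀ x, (inner ℝ (Ψ x) t) ^ 2 = ∑ i, ∑ j, t i * (t j * (Ψ x i * Ψ x j)) := by
    intro x
    rw [sq, PiLp.inner_apply, Finset.sum_mul_sum]
    refine Finset.sum_congr rfl fun i _ => Finset.sum_congr rfl fun j _ => ?_
    simp; ring
  simp_rw [h1]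
  rw [integral_finsetSum _ fun i _ => integrable_finsetSum _ fun j _ =>
    ((hint i j).const_mul _).const_mul _]
  simp_rw [dotProduct, Matrix.mulVec, dotProduct, Finset.mul_sum]
  refine Finset.sum_congr rfl fun i _ => ?_
  rw [integral_finsetSum _ fun j _ => ((hint i j).const_mul _).const_mul _]
  refine Finset.sum_congr rfl fun j _ => ?_
  rw [integral_const_mul, integral_const_mul, hS]; ring

/-- The multivariate central limit theorem for a centered function of an independent sample. -/
theorem clt_sample_multivariate [IsProbabilityMeasure Pr] {ι : Type*} [Fintype ι] [DecidableEq ι]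
    (hX : ∀ i, HasLaw (X i) P Pr) (hind : iIndepFun X Pr) {Ψ : 𝒳 → EuclideanSpace ℝ ι}
    (hΨ : ∀ i, MemLp (fun x => Ψ x i) 2 P) (hmean : ∀ i, ∫ x, Ψ x i ∂P = 0) {S : Matrix ι ι ℝ}
    (hS : ∀ i j, ∫ x, Ψ x i * Ψ x j ∂P = S i j) :
    TendstoInDistribution (fun (n : ℕ) ω => (√n)⁻¹ • ∑ i ∈ Finset.range n, Ψ (X i ω)) atTop id
      (fun _ => Pr) (multivariateGaussian 0 S) := by
  have : IsProbabilityMeasure P := (hX 0).isProbabilityMeasure_iff.1 inferInstance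
  have hΨm : AEMeasurable Ψ P := by
    have : AEMeasurable (fun x => WithLp.toLp 2 (fun i => Ψ x i)) P :=
      (WithLp.measurable_toLp 2 _).comp_aemeasurable
        (aemeasurable_pi_lambda _ fun i => (hΨ i).aestronglyMeasurable.aemeasurable)
    exact this
  have hquad := posSemidef_secondMoment hΨ hS
  have hpsd : S.PosSemidef := by
    refine Matrix.PosSemidef.of_dotProduct_mulVec_nonneg ?_ fun v => ?_
    · ext i j
      simp only [Matrix.conjTranspose_apply, star_trivial]
      rw [← hS, ← hS]
      simp_rw [mul_comm]
    · have := hquad (WithLp.toLp 2 v)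
      simp only [star_trivial]
      rw [← this]
      exact integral_nonneg fun x => sq_nonneg _
  have hm : ∀ n : ℕ, AEMeasurable (fun ω => (√n)⁻¹ • ∑ i ∈ Finset.range n, Ψ (X i ω)) Pr := by
    intro n
    refine AEMeasurable.fun_const_smul (Finset.aemeasurable_fun_sum _ fun i _ => ?_) _
    exact AEMeasurable.comp_aemeasurable (by rwa [(hX i).map_eq]) (hX i).aemeasurable
  refine ⟨hm, aemeasurable_id, ProbabilityMeasure.tendsto_iff_tendsto_charFun.2 fun t => ?_⟩
  simp only [ProbabilityMeasure.coe_mk, Measure.map_id]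
  have hin : ∀ x, inner ℝ (Ψ x) t = ∑ i, t i * Ψ x i := fun x => by
    rw [PiLp.inner_apply]; simp
  have hL : MemLp (fun x => inner ℝ (Ψ x) t) 2 P := by
    simp_rw [hin]
    exact memLp_finsetSum _ fun i _ => (hΨ i).const_mul _
  have hmean0 : ∫ x, inner ℝ (Ψ x) t ∂P = 0 := by
    simp_rw [hin]
    rw [integral_finsetSum _ fun i _ => ((hΨ i).integrable (by norm_num)).const_mul _]
    simp_rw [integral_const_mul, hmean]
    simp
  have h2 := ProbabilityMeasure.tendsto_iff_tendsto_charFun.1 (clt_sample hX hind hL).tendsto 1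
  simp only [ProbabilityMeasure.coe_mk, Measure.map_id, hmean0, mul_zero, sub_zero] at h2
  have hlim : charFun (multivariateGaussian 0 S) t =
      charFun (gaussianReal 0 (Real.toNNReal (∫ x, (inner ℝ (Ψ x) t) ^ 2 ∂P - 0 ^ 2))) 1 := by
    rw [charFun_multivariateGaussian hpsd, charFun_gaussianReal, hquad]
    have h0 : 0 ≤ t.ofLp ⬝ᵥ S.mulVec t.ofLp := by
      rw [← hquad]; exact integral_nonneg fun x => sq_nonneg _
    simp [Real.coe_toNNReal _ h0]
  rw [hlim]
  refine h2.congr fun n => ?_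
  rw [charFun_map_eq_charFun_map_inner (hm n)]
  congr 2
  ext ω
  rw [real_inner_smul_left, sum_inner]

end Sample

/-! ### Sums of functions with bounded third derivative -/

section Sums

variable {E : Type*} [NormedAddCommGroup E] [NormedSpace ℝ E] {W : Set E}

theorem BoundedThirdDeriv.mono {K : E → ℝ} {M N : ℝ} (hK : BoundedThirdDeriv K W M)
    (h : M ≤ N) : BoundedThirdDeriv K W N :=
  fun z hz => ⟨(hK z hz).1, (hK z hz).2.trans h⟩

theorem BoundedThirdDeriv.add {K L : E → ℝ} {M N : ℝ} (hK : BoundedThirdDeriv K W M)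
    (hL : BoundedThirdDeriv L W N) : BoundedThirdDeriv (fun z => K z + L z) W (M + N) := by
  intro z hz
  refine ⟨(hK z hz).1.add (hL z hz).1, ?_⟩
  have : iteratedFDeriv ℝ 3 (fun z => K z + L z) z =
      iteratedFDeriv ℝ 3 K z + iteratedFDeriv ℝ 3 L z :=
    iteratedFDeriv_add_apply (hK z hz).1 (hL z hz).1
  rw [this]
  exact (norm_add_le _ _).trans (add_le_add (hK z hz).2 (hL z hz).2)

theorem BoundedThirdDeriv.const_mul {K : E → ℝ} {M a : ℝ} (ha : 0 ≤ a)
    (hK : BoundedThirdDeriv K W M) : BoundedThirdDeriv (fun z => a * K z) W (a * M) := by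
  intro z hz
  refine ⟨contDiffAt_const.mul (hK z hz).1, ?_⟩
  rw [show (fun z => a * K z) = a • K from rfl, iteratedFDeriv_const_smul_apply (hK z hz).1, norm_smul, Real.norm_of_nonneg ha]
  exact mul_le_mul_of_nonneg_left (hK z hz).2 ha

theorem BoundedThirdDeriv.sum {K : ℕ → E → ℝ} {M : ℕ → ℝ}
    (hK : ∀ i, BoundedThirdDeriv (K i) W (M i)) (n : ℕ) :
    BoundedThirdDeriv (fun z => ∑ i ∈ Finset.range n, K i z) W (∑ i ∈ Finset.range n, M i) := by
  induction n with
  | zero =>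
    intro z _
    simp only [Finset.range_zero, Finset.sum_empty]
    refine ⟨contDiffAt_const, ?_⟩
    have : iteratedFDeriv ℝ 3 (fun _ : E => (0 : ℝ)) z = 0 := by
      rw [iteratedFDeriv_const_of_ne (by norm_num)]; rfl
    rw [this, norm_zero]
  | succ n ih =>
    simp_rw [Finset.sum_range_succ]
    exact ih.add (hK n)

theorem fderiv_mean {K : ℕ → E → ℝ} {M : ℕ → ℝ} (hK : ∀ i, BoundedThirdDeriv (K i) W (M i))
    (n : ℕ) {z : E} (hz : z ∈ W) :
    fderiv ℝ (fun z => (n : ℝ)⁻¹ * ∑ i ∈ Finset.range n, K i z) z =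
      (n : ℝ)⁻¹ • ∑ i ∈ Finset.range n, fderiv ℝ (K i) z :=
  ((HasFDerivAt.fun_sum fun i _ => (hK i).hasFDerivAt hz).const_mul _).fderiv

theorem fderiv_fderiv_mean {K : ℕ → E → ℝ} {M : ℕ → ℝ}
    (hK : ∀ i, BoundedThirdDeriv (K i) W (M i)) (hW : IsOpen W) (n : ℕ) {z : E} (hz : z ∈ W) :
    fderiv ℝ (fderiv ℝ (fun z => (n : ℝ)⁻¹ * ∑ i ∈ Finset.range n, K i z)) z =
      (n : ℝ)⁻¹ • ∑ i ∈ Finset.range n, fderiv ℝ (fderiv ℝ (K i)) z := by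
  -- Differentiating again needs the gradient formula on a whole neighborhood, hence `W` open.
  have h1 : fderiv ℝ (fun z => (n : ℝ)⁻¹ * ∑ i ∈ Finset.range n, K i z) =ᶠ[𝓝 z]
      fun z => (n : ℝ)⁻¹ • ∑ i ∈ Finset.range n, fderiv ℝ (K i) z := by
    filter_upwards [hW.mem_nhds hz] with y hy using fderiv_mean hK n hy
  rw [h1.fderiv_eq]
  exact ((HasFDerivAt.fun_sum fun i _ => (hK i).hasFDerivAt_fderiv hz).fun_const_smul _).fderiv

end Sums

/-! ### Families of smooth functions indexed by the observation -/

/-- The `i`-th coordinate, as a continuous linear form. -/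
noncomputable def coord {ι : Type*} (i : ι) : EuclideanSpace ℝ ι →L[ℝ] ℝ := EuclideanSpace.proj i

@[simp]
theorem coord_apply {ι : Type*} (i : ι) (v : EuclideanSpace ℝ ι) : coord i v = v i := rfl

section Family

set_option maxSynthPendingDepth 3

variable {ι : Type*} [Fintype ι] [DecidableEq ι]

theorem partialDeriv_partialDeriv {K : EuclideanSpace ℝ ι → ℝ} {W : Set (EuclideanSpace ℝ ι)}
    {M : ℝ} (hK : BoundedThirdDeriv K W M) {z : EuclideanSpace ℝ ι} (hz : z ∈ W) (i j : ι) :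
    partialDeriv (partialDeriv K j) i z =
      fderiv ℝ (fderiv ℝ K) z (EuclideanSpace.single i 1) (EuclideanSpace.single j 1) := by
  have h := (hK.hasFDerivAt_fderiv hz).clm_apply (hasFDerivAt_const (EuclideanSpace.single j 1) z)
  have h2 : fderiv ℝ (partialDeriv K j) z = _ := h.fderiv
  rw [partialDeriv, h2]
  simp

theorem eq_sum_single (v : EuclideanSpace ℝ ι) :
    v = ∑ i, v i • EuclideanSpace.single i (1 : ℝ) := by
  ext j; simp [Pi.single_apply]

/-- With `bilin_eq_sum`, this carries integrability of the individual partial derivatives over to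
the operator-valued derivatives. -/
theorem clm_eq_sum (L : EuclideanSpace ℝ ι →L[ℝ] ℝ) :
    L = ∑ i, L (EuclideanSpace.single i 1) • coord i := by
  ext v
  conv_lhs => rw [eq_sum_single v]
  simp [mul_comm]

theorem bilin_eq_sum (Q : EuclideanSpace ℝ ι →L[ℝ] EuclideanSpace ℝ ι →L[ℝ] ℝ) :
    Q = ∑ i, ∑ j, Q (EuclideanSpace.single i 1) (EuclideanSpace.single j 1) •
      (coord i).smulRight
        (coord j) := by
  ext v w
  conv_lhs => rw [eq_sum_single v]
  simp only [map_sum, map_smul, _root_.sum_apply, _root_.smul_apply]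
  refine Finset.sum_congr rfl fun i _ => ?_
  conv_lhs => rw [clm_eq_sum (Q (EuclideanSpace.single i 1))]
  simp [Finset.mul_sum]
  refine Finset.sum_congr rfl fun j _ => ?_
  ring

variable {𝒳 : Type*} [MeasurableSpace 𝒳]

/-- A family `k x`, `x ∈ 𝒳`, of functions which are smooth on the ball of radius `r` about `c`,
their third derivatives being dominated by the integrable function `H`, with square integrable
values and gradients and integrable Hessians at `c`. -/
structure IsSmoothFamily (P : Measure 𝒳) (k : 𝒳 → EuclideanSpace ℝ ι → ℝ)
    (c : EuclideanSpace ℝ ι) (r : ℝ) (H : 𝒳 → ℝ) : Prop where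
  pos : 0 < r
  integrable_bound : Integrable H P
  aestronglyMeasurable : ∀ z ∈ Metric.ball c r, AEStronglyMeasurable (fun x => k x z) P
  bounded : ∀ᵐ x ∂P, BoundedThirdDeriv (k x) (Metric.ball c r) (H x)
  integrable_sq : Integrable (fun x => k x c ^ 2) P
  integrable_grad_sq : ∀ i, Integrable (fun x => partialDeriv (k x) i c ^ 2) P
  integrable_hess : ∀ i j, Integrable (fun x => partialDeriv (partialDeriv (k x) j) i c) P

variable {P : Measure 𝒳} {k : 𝒳 → EuclideanSpace ℝ ι → ℝ} {c : EuclideanSpace ℝ ι}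
  {r : ℝ} {H : 𝒳 → ℝ}

theorem IsSmoothFamily.mem_ball (hk : IsSmoothFamily P k c r H) : c ∈ Metric.ball c r :=
  Metric.mem_ball_self hk.pos

theorem IsSmoothFamily.memLp (hk : IsSmoothFamily P k c r H) : MemLp (fun x => k x c) 2 P :=
  (memLp_two_iff_integrable_sq (hk.aestronglyMeasurable c hk.mem_ball)).2 hk.integrable_sq

/-- Integrability of the square does not make the derivative itself measurable in `x`; it is
measurable as an almost everywhere limit of difference quotients. -/
theorem IsSmoothFamily.memLp_partialDeriv (hk : IsSmoothFamily P k c r H) (i : ι) :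
    MemLp (fun x => partialDeriv (k x) i c) 2 P := by
  refine (memLp_two_iff_integrable_sq ?_).2 (hk.integrable_grad_sq i)
  -- The increments `(t n)⁻¹ = r / (2 (n + 1))` are at most `r / 2`, so the shifted points stay in
  -- the ball.
  set t : ℕ → ℝ := fun n => 2 * (n + 1) / r with ht
  have hr := hk.pos
  have htpos : ∀ n, 0 < t n := fun n => by positivity
  have htt : Tendsto t atTop atTop := by
    refine Tendsto.atTop_div_const hr (Tendsto.const_mul_atTop two_pos ?_)
    exact tendsto_atTop_add_const_right _ _ tendsto_natCast_atTop_atTop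
  refine aestronglyMeasurable_of_tendsto_ae atTop
    
    (f := fun (n : ℕ) x => t n • (k x (c + (t n)⁻¹ • EuclideanSpace.single i (1 : ℝ)) - k x c)) (fun n => ?_) ?_
  · refine AEStronglyMeasurable.const_smul (f := fun x =>
      k x (c + (t n)⁻¹ • EuclideanSpace.single i (1 : ℝ)) - k x c)
      ((hk.aestronglyMeasurable _ ?_).sub (hk.aestronglyMeasurable c hk.mem_ball)) (t n)
    rw [mem_ball_iff_norm, add_sub_cancel_left, norm_smul, PiLp.norm_single]
    rw [Real.norm_of_nonneg (inv_nonneg.2 (htpos n).le), norm_one, mul_one, ht,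
      inv_div, div_lt_iff₀ (by positivity)]
    nlinarith [hr, (Nat.cast_nonneg n : (0 : ℝ) ≤ n), mul_nonneg hr.le (Nat.cast_nonneg (α := ℝ) n)]
  · filter_upwards [hk.bounded] with x hx
    exact ((hx.hasFDerivAt hk.mem_ball).lim_real (EuclideanSpace.single i 1)).comp htt

theorem IsSmoothFamily.integrable_fderiv [IsFiniteMeasure P] (hk : IsSmoothFamily P k c r H) :
    Integrable (fun x => fderiv ℝ (k x) c) P := by
  have : (fun x => fderiv ℝ (k x) c) = fun x => ∑ i, partialDeriv (k x) i c •
      coord i :=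
    funext fun x => clm_eq_sum _
  rw [this]
  exact integrable_finsetSum _ fun i _ =>
    ((hk.memLp_partialDeriv i).integrable (by norm_num)).smul_const _

theorem IsSmoothFamily.integrable_hessian (hk : IsSmoothFamily P k c r H) :
    Integrable (fun x => fderiv ℝ (fderiv ℝ (k x)) c) P := by
  refine Integrable.congr (integrable_finsetSum Finset.univ fun i _ =>
    integrable_finsetSum Finset.univ fun j _ => (hk.integrable_hess i j).smul_const
      ((coord i).smulRight
        (coord j))) ?_
  filter_upwards [hk.bounded] with x hx
  simp_rw [partialDeriv_partialDeriv hx hk.mem_ball]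
  exact (bilin_eq_sum _).symm

theorem IsSmoothFamily.integral_hessian_apply (hk : IsSmoothFamily P k c r H)
    (u v : EuclideanSpace ℝ ι) :
    (∫ x, fderiv ℝ (fderiv ℝ (k x)) c ∂P) u v = ∫ x, fderiv ℝ (fderiv ℝ (k x)) c u v ∂P := by
  rw [ContinuousLinearMap.integral_apply hk.integrable_hessian,
    ContinuousLinearMap.integral_apply (hk.integrable_hessian.apply_continuousLinearMap u)]

theorem IsSmoothFamily.integral_hessian_symm (hk : IsSmoothFamily P k c r H)
    (u v : EuclideanSpace ℝ ι) :
    (∫ x, fderiv ℝ (fderiv ℝ (k x)) c ∂P) u v = (∫ x, fderiv ℝ (fderiv ℝ (k x)) c ∂P) v u := by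
  rw [hk.integral_hessian_apply, hk.integral_hessian_apply]
  refine integral_congr_ae ?_
  filter_upwards [hk.bounded] with x hx using hx.symm hk.mem_ball u v

theorem IsSmoothFamily.ae_taylor (hk : IsSmoothFamily P k c r H) {z : EuclideanSpace ℝ ι}
    (hz : z ∈ Metric.ball c r) :
    ∀ᵐ x ∂P, |k x z - k x c - fderiv ℝ (k x) c (z - c) -
      1 / 2 * fderiv ℝ (fderiv ℝ (k x)) c (z - c) (z - c)| ≤ H x * ‖z - c‖ ^ 3 := by
  filter_upwards [hk.bounded] with x hx using hx.abs_sub_le (convex_ball c r) hk.mem_ball hz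

theorem IsSmoothFamily.integrable_remainder [IsFiniteMeasure P] (hk : IsSmoothFamily P k c r H)
    {z : EuclideanSpace ℝ ι} (hz : z ∈ Metric.ball c r) :
    Integrable (fun x => k x z - k x c - fderiv ℝ (k x) c (z - c) -
      1 / 2 * fderiv ℝ (fderiv ℝ (k x)) c (z - c) (z - c)) P := by
  refine (hk.integrable_bound.mul_const (‖z - c‖ ^ 3)).mono' ?_ (hk.ae_taylor hz)
  exact (((hk.aestronglyMeasurable z hz).sub (hk.aestronglyMeasurable c hk.mem_ball)).sub
    (hk.integrable_fderiv.apply_continuousLinearMap _).aestronglyMeasurable).sub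
    (((hk.integrable_hessian.apply_continuousLinearMap _).apply_continuousLinearMap
      _).const_mul _).aestronglyMeasurable

/-- Integrability is assumed at `c` only. It spreads to the ball because the Taylor polynomial at
`c` is integrable and the remainder is dominated by a multiple of `H`. -/
theorem IsSmoothFamily.integrable [IsFiniteMeasure P] (hk : IsSmoothFamily P k c r H)
    {z : EuclideanSpace ℝ ι} (hz : z ∈ Metric.ball c r) : Integrable (fun x => k x z) P := by
  have h := (((hk.integrable_remainder hz).add
    (((hk.integrable_hessian.apply_continuousLinearMap (z - c)).apply_continuousLinearMap
      (z - c)).const_mul (1 / 2))).add (hk.integrable_fderiv.apply_continuousLinearMap (z - c))).add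
    (hk.memLp.integrable (by norm_num))
  refine h.congr (ae_of_all _ fun x => ?_)
  simp

/-- The Taylor expansion of the mean of the family. -/
theorem IsSmoothFamily.integral_taylor [IsFiniteMeasure P] (hk : IsSmoothFamily P k c r H)
    {z : EuclideanSpace ℝ ι} (hz : z ∈ Metric.ball c r) :
    |∫ x, k x z ∂P - ∫ x, k x c ∂P - (∫ x, fderiv ℝ (k x) c ∂P) (z - c) -
      1 / 2 * (∫ x, fderiv ℝ (fderiv ℝ (k x)) c ∂P) (z - c) (z - c)| ≤
      (∫ x, H x ∂P) * ‖z - c‖ ^ 3 := by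
  have h := norm_integral_le_of_norm_le (f := fun x => k x z - k x c -
    fderiv ℝ (k x) c (z - c) - 1 / 2 * fderiv ℝ (fderiv ℝ (k x)) c (z - c) (z - c)) (hk.integrable_bound.mul_const (‖z - c‖ ^ 3))
    (hk.ae_taylor hz)
  have h1 := hk.integrable hz
  have h2 := hk.integrable hk.mem_ball
  have h3 := hk.integrable_fderiv.apply_continuousLinearMap (z - c)
  have h4 := ((hk.integrable_hessian.apply_continuousLinearMap (z - c)).apply_continuousLinearMap
      (z - c)).const_mul (1 / 2)
  have h12 : Integrable (fun x => k x z - k x c) P := h1.sub h2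
  have h123 : Integrable (fun x => k x z - k x c - fderiv ℝ (k x) c (z - c)) P := h12.sub h3
  rw [integral_mul_const, integral_sub h123 h4, integral_sub h12 h3,
    integral_sub h1 h2, integral_const_mul, ← hk.integral_hessian_apply,
    ← ContinuousLinearMap.integral_apply hk.integrable_fderiv, Real.norm_eq_abs] at h
  exact h

end Family

/-! ### Asymptotics of empirical saddle points -/

section Empirical

set_option maxSynthPendingDepth 3

variable {ι : Type*} [Fintype ι] [DecidableEq ι]
variable {𝒳 : Type*} [MeasurableSpace 𝒳] {Ω : Type*} [MeasurableSpace Ω] {Pr : Measure Ω}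
  {P : Measure 𝒳} {X : ℕ → Ω → 𝒳} {k : 𝒳 → EuclideanSpace ℝ ι → ℝ} {c : EuclideanSpace ℝ ι}
  {r : ℝ} {H : 𝒳 → ℝ}

/-- The empirical mean of the family `k`, as a function of the parameter. -/
noncomputable def empCriterion (k : 𝒳 → EuclideanSpace ℝ ι → ℝ) (X : ℕ → Ω → 𝒳) (n : ℕ) (ω : Ω)
    (z : EuclideanSpace ℝ ι) : ℝ := empMean X n ω (fun x => k x z)

theorem IsSmoothFamily.ae_sample (hk : IsSmoothFamily P k c r H) (hX : ∀ i, HasLaw (X i) P Pr) :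
    ∀ᵐ ω ∂Pr, ∀ n,
      BoundedThirdDeriv (empCriterion k X n ω) (Metric.ball c r)
        ((n : ℝ)⁻¹ * ∑ i ∈ Finset.range n, H (X i ω)) ∧
      fderiv ℝ (empCriterion k X n ω) c =
        (n : ℝ)⁻¹ • ∑ i ∈ Finset.range n, fderiv ℝ (k (X i ω)) c ∧
      fderiv ℝ (fderiv ℝ (empCriterion k X n ω)) c =
        (n : ℝ)⁻¹ • ∑ i ∈ Finset.range n, fderiv ℝ (fderiv ℝ (k (X i ω))) c := by
  filter_upwards [PhiDivergence.ae_sample hX hk.bounded] with ω hω n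
  exact ⟨(BoundedThirdDeriv.sum hω n).const_mul (by positivity), fderiv_mean hω n hk.mem_ball,
    fderiv_fderiv_mean hω Metric.isOpen_ball n hk.mem_ball⟩

/-- The law of large numbers for `H` and for the Hessian at the single point `c`. The resulting
deterministic bound on third derivatives makes the empirical Hessians equi-Lipschitz, so no uniform
law of large numbers is needed. -/
theorem IsSmoothFamily.highProb_bounded [IsProbabilityMeasure Pr]
    (hk : IsSmoothFamily P k c r H) (hX : ∀ i, HasLaw (X i) P Pr) (hind : iIndepFun X Pr)
    {δ : ℝ} (hδ : 0 < δ) :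
    HighProb Pr (fun n ω =>
      BoundedThirdDeriv (empCriterion k X n ω) (Metric.ball c r) (|∫ x, H x ∂P| + 1) ∧
      ‖fderiv ℝ (fderiv ℝ (empCriterion k X n ω)) c -
        ∫ x, fderiv ℝ (fderiv ℝ (k x)) c ∂P‖ < δ) := by
  have h1 := highProb_sampleMean hX hind hk.integrable_bound one_pos
  have h2 := highProb_sampleMean hX hind hk.integrable_hessian hδ
  have h3 := HighProb.of_ae fun n => (hk.ae_sample hX).mono fun ω hω => hω n
  refine ((h1.and h2).and h3).mono fun n ω hω => ?_
  obtain ⟨⟨hω1, hω2⟩, hω3, -, hω4⟩ := hω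
  rw [hω4]
  refine ⟨hω3.mono ?_, hω2⟩
  rw [smul_eq_mul, Real.norm_eq_abs] at hω1
  linarith [(abs_lt.1 hω1).2, le_abs_self (∫ x, H x ∂P)]

end Empirical

/-! ### Consistency and stationarity of the saddle point estimates. -/

section SaddleEstimates

set_option maxSynthPendingDepth 3

variable {m d : ℕ}
variable {𝒳 : Type*} [MeasurableSpace 𝒳] {Ω : Type*} [MeasurableSpace Ω] {Pr : Measure Ω}
  {P : Measure 𝒳} {X : ℕ → Ω → 𝒳} {k : 𝒳 → EuclideanSpace ℝ (Fin m ⊕ Fin d) → ℝ}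
  {βs : EuclideanSpace ℝ (Fin m)} {θT : EuclideanSpace ℝ (Fin d)} {r : ℝ} {H : 𝒳 → ℝ}
  {βhat : ℕ → Ω → EuclideanSpace ℝ (Fin m)}
  {αhat : ℕ → Ω → EuclideanSpace ℝ (Fin m) → EuclideanSpace ℝ (Fin d)}

/-- The mean of the family `k` has a saddle point at `(βs, θT)`: it is maximal at `θT` in the
second argument for each value of the first one, and the maximum is minimal at `βs`. -/
def IsMeanSaddle (P : Measure 𝒳) (k : 𝒳 → EuclideanSpace ℝ (Fin m ⊕ Fin d) → ℝ)
    (βs : EuclideanSpace ℝ (Fin m)) (θT : EuclideanSpace ℝ (Fin d)) (r : ℝ) : Prop :=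
  (∀ b a, ‖joint b a‖ < r →
    ∫ x, k x (joint βs θT + joint b a) ∂P ≤ ∫ x, k x (joint βs θT + joint b 0) ∂P) ∧
  ∀ b, ‖b‖ < r → ∫ x, k x (joint βs θT) ∂P ≤ ∫ x, k x (joint βs θT + joint b 0) ∂P

/-- The estimates `(β̂, α̂(β̂))` are saddle points of the empirical criterion in a neighborhood,
with probability tending to one, and they are consistent. -/
structure IsSaddleEstimate (Pr : Measure Ω) (X : ℕ → Ω → 𝒳)
    (k : 𝒳 → EuclideanSpace ℝ (Fin m ⊕ Fin d) → ℝ)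
    (βs : EuclideanSpace ℝ (Fin m)) (θT : EuclideanSpace ℝ (Fin d))
    (βhat : ℕ → Ω → EuclideanSpace ℝ (Fin m))
    (αhat : ℕ → Ω → EuclideanSpace ℝ (Fin m) → EuclideanSpace ℝ (Fin d)) : Prop where
  consistent : TendstoInMeasure Pr βhat atTop (fun _ => βs)
  isLocalMax : HighProb Pr (fun n ω =>
    IsLocalMax (fun a => empCriterion k X n ω (joint (βhat n ω) a)) (αhat n ω (βhat n ω)))
  le_of_near : ∀ ε > 0, HighProb Pr (fun n ω => ∀ᶠ β in 𝓝 (βhat n ω), ‖αhat n ω β - θT‖ < ε ∧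
    empCriterion k X n ω (joint (βhat n ω) (αhat n ω (βhat n ω))) ≤
      empCriterion k X n ω (joint β (αhat n ω β)))

theorem IsSmoothFamily.mean_saddle_expansion [IsFiniteMeasure P]
    (hk : IsSmoothFamily P k (joint βs θT) r H) (hsad : IsMeanSaddle P k βs θT r) :
    ∫ x, fderiv ℝ (k x) (joint βs θT) ∂P = 0 ∧
    ∀ b a, (∫ x, fderiv ℝ (fderiv ℝ (k x)) (joint βs θT) ∂P) (joint b a) (joint b a) ≤
      (∫ x, fderiv ℝ (fderiv ℝ (k x)) (joint βs θT) ∂P) (joint b 0) (joint b 0) := by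
  refine expansion_of_saddle (F := fun w => ∫ x, k x (joint βs θT + w) ∂P) (M := ∫ x, H x ∂P)
    hk.pos (fun w hw => ?_) hsad.1 fun b hb => ?_
  · have := hk.integral_taylor (z := joint βs θT + w) (by rwa [mem_ball_iff_norm, add_sub_cancel_left])
    rw [add_sub_cancel_left] at this
    simpa only [add_zero] using this
  · simpa only [add_zero] using hsad.2 b hb

omit [MeasurableSpace 𝒳] in
theorem IsSaddleEstimate.highProb_norm_sub_lt
    (hest : IsSaddleEstimate Pr X k βs θT βhat αhat) {ε : ℝ} (hε : 0 < ε) :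
    HighProb Pr (fun n ω =>
      ‖joint (βhat n ω) (αhat n ω (βhat n ω)) - joint βs θT‖ < ε) := by
  refine ((PhiDivergence.highProb_norm_sub_lt hest.consistent (half_pos hε)).and
    (hest.le_of_near _ (half_pos hε))).mono fun n ω hω => ?_
  rw [← joint_sub]
  have h1 := norm_joint_le (βhat n ω - βs) (αhat n ω (βhat n ω) - θT)
  have h2 := hω.2.self_of_nhds.1
  linarith [hω.1]

/-- With probability tending to one the estimates are stationary points of the empirical
criterion. -/
theorem IsSaddleEstimate.highProb_fderiv_eq_zero [IsProbabilityMeasure Pr] [IsFiniteMeasure P]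
    (hk : IsSmoothFamily P k (joint βs θT) r H) (hsad : IsMeanSaddle P k βs θT r)
    (hnd : ∀ w, (∀ v, (∫ x, fderiv ℝ (fderiv ℝ (k x)) (joint βs θT) ∂P) w v = 0) → w = 0)
    (hX : ∀ i, HasLaw (X i) P Pr) (hind : iIndepFun X Pr)
    (hest : IsSaddleEstimate Pr X k βs θT βhat αhat) :
    HighProb Pr (fun n ω =>
      fderiv ℝ (empCriterion k X n ω) (joint (βhat n ω) (αhat n ω (βhat n ω))) = 0) := by
  obtain ⟨κ, hκ, hneg⟩ := exists_neg_bound_of_saddle hk.integral_hessian_symm hnd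
    (hk.mean_saddle_expansion hsad).2
  set Q := ∫ x, fderiv ℝ (fderiv ℝ (k x)) (joint βs θT) ∂P with hQ
  set M := |∫ x, H x ∂P| + 1 with hM
  have hMpos : 0 < M := by positivity
  have hr := hk.pos
  -- Points within `ε` in each block are within `2 ε` of the centre and `4 ε` of each other. Thus
  -- they stay in the ball, and `M * (4 * ε) ≤ (κ / 2) / 8` is what `fderiv_eq_zero_of_saddle`
  -- requires for the concavity constant `κ / 2`.
  set ε := min (r / 4) (κ / (64 * M)) with hε
  have hεpos : 0 < ε := by positivity
  have hε1 : ε ≤ r / 4 := min_le_left _ _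
  have hε2 : M * ε ≤ κ / 64 := by
    have : ε ≤ κ / (64 * M) := min_le_right _ _
    calc M * ε ≤ M * (κ / (64 * M)) := by gcongr
      _ = κ / 64 := by field_simp
  refine ((((hk.highProb_bounded hX hind (δ := κ / 4) (by positivity)).and
    (PhiDivergence.highProb_norm_sub_lt hest.consistent hεpos)).and (hest.le_of_near ε hεpos)).and
    hest.isLocalMax).mono fun n ω hω => ?_
  obtain ⟨⟨⟨⟨hb, hQn⟩, hβ⟩, hnear⟩, hmax⟩ := hω
  have hdist : ∀ β α, ‖β - βs‖ < ε → ‖α - θT‖ < ε → ‖joint β α - joint βs θT‖ < 2 * ε := by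
    intro β α h1 h2
    rw [← joint_sub]
    linarith [norm_joint_le (β - βs) (α - θT)]
  have hα := hnear.self_of_nhds.1
  have hc := hdist _ _ hβ hα
  have hmem : ∀ z, ‖z - joint βs θT‖ < 2 * ε → z ∈ Metric.ball (joint βs θT) r := by
    intro z hz
    rw [mem_ball_iff_norm]; linarith
  refine fderiv_eq_zero_of_saddle hb (convex_ball _ _) (hmem _ hc) (half_pos hκ) (fun a => ?_)
    (ε := 4 * ε) (by linarith) hmax ?_
  · have h1 := hb.norm_hessian_sub_le (convex_ball _ _) hk.mem_ball (hmem _ hc)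
    set D := fderiv ℝ (fderiv ℝ (empCriterion k X n ω)) with hD
    set ĉ := joint (βhat n ω) (αhat n ω (βhat n ω)) with hĉ
    -- Sampling error at the centre (`κ / 4`) plus displacement to the estimate (`2 M ε ≤ κ / 32`):
    -- half of the concavity survives.
    have h2 : ‖D ĉ - Q‖ ≤ κ / 2 := by
      have h3 : ‖D ĉ - Q‖ ≤ ‖D ĉ - D (joint βs θT)‖ + ‖D (joint βs θT) - Q‖ :=
        norm_sub_le_norm_sub_add_norm_sub _ _ _
      have h4 : M * ‖ĉ - joint βs θT‖ ≤ M * (2 * ε) := by gcongr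
      linarith
    have h5 : (D ĉ - Q) (joint 0 a) (joint 0 a) ≤ κ / 2 * ‖a‖ ^ 2 := by
      refine (le_abs_self _).trans (((D ĉ - Q).le_opNorm₂ _ _).trans ?_)
      rw [norm_joint_zero_left, mul_assoc, ← sq]
      gcongr
    simp only [_root_.sub_apply] at h5
    linarith [hneg a]
  · have hopen : ∀ᶠ β in 𝓝 (βhat n ω), ‖β - βs‖ < ε :=
      (continuous_id.sub continuous_const).norm.continuousAt.eventually_lt continuousAt_const hβ
    filter_upwards [hnear, hopen] with β h1 h2
    have h3 := hdist _ _ h2 h1.1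
    refine ⟨αhat n ω β, hmem _ h3, ?_, h1.2⟩
    have := norm_sub_le_norm_sub_add_norm_sub (joint β (αhat n ω β)) (joint βs θT)
      (joint (βhat n ω) (αhat n ω (βhat n ω)))
    rw [norm_sub_rev (joint βs θT)] at this
    linarith

end SaddleEstimates

/-! ### Asymptotic normality of empirical saddle points -/

section Normality

set_option maxSynthPendingDepth 3

variable {ι : Type*} [Fintype ι] [DecidableEq ι]

/-- The linear map sending a linear form with coordinate vector `v` to the vector `S v`. -/
noncomputable def dualMulVec (S : Matrix ι ι ℝ) :
    (EuclideanSpace ℝ ι →L[ℝ] ℝ) →L[ℝ] EuclideanSpace ℝ ι :=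
  LinearMap.toContinuousLinearMap
    { toFun := fun L => WithLp.toLp 2 (S.mulVec fun i => L (EuclideanSpace.single i 1))
      map_add' := fun L L' => by
        ext i
        simp [Matrix.mulVec, dotProduct, mul_add, Finset.sum_add_distrib]
      map_smul' := fun t L => by
        ext i
        simp [Matrix.mulVec, dotProduct, Finset.mul_sum, mul_left_comm] }

/-- By symmetry the linear form `Q v` has coordinate vector `A v`, so multiplication by `A⁻¹`
recovers `v`. -/
theorem dualMulVec_inv_bilin {A : Matrix ι ι ℝ} (hA : IsUnit A.det)
    {Q : EuclideanSpace ℝ ι →L[ℝ] EuclideanSpace ℝ ι →L[ℝ] ℝ} (hsymm : ∀ u v, Q u v = Q v u)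
    (hQ : ∀ i j, Q (EuclideanSpace.single i 1) (EuclideanSpace.single j 1) = A i j)
    (v : EuclideanSpace ℝ ι) : dualMulVec A⁻¹ (Q v) = v := by
  have h1 : (fun j => Q v (EuclideanSpace.single j 1)) = A.mulVec v.ofLp := by
    ext j
    rw [hsymm]
    conv_lhs => rw [eq_sum_single v]
    simp [hQ, Matrix.mulVec, dotProduct, mul_comm]
  have h2 : dualMulVec A⁻¹ (Q v) =
    WithLp.toLp 2 (A⁻¹.mulVec fun j => Q v (EuclideanSpace.single j 1)) := rfl
  rw [h2, h1, Matrix.mulVec_mulVec, Matrix.nonsing_inv_mul _ hA, Matrix.one_mulVec]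

variable {m d : ℕ}
variable {𝒳 : Type*} [MeasurableSpace 𝒳] {Ω : Type*} [MeasurableSpace Ω] {Pr : Measure Ω}
  [IsProbabilityMeasure Pr] {P : Measure 𝒳} {X : ℕ → Ω → 𝒳}
  {k : 𝒳 → EuclideanSpace ℝ (Fin m ⊕ Fin d) → ℝ}
  {βs : EuclideanSpace ℝ (Fin m)} {θT : EuclideanSpace ℝ (Fin d)} {r : ℝ} {H : 𝒳 → ℝ}
  {βhat : ℕ → Ω → EuclideanSpace ℝ (Fin m)}
  {αhat : ℕ → Ω → EuclideanSpace ℝ (Fin m) → EuclideanSpace ℝ (Fin d)}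
  {A F : Matrix (Fin m ⊕ Fin d) (Fin m ⊕ Fin d) ℝ}

/-- The central limit theorem for the linearized estimator. -/
theorem IsSmoothFamily.clt_dualMulVec {ι : Type*} [Fintype ι] [DecidableEq ι]
    {k : 𝒳 → EuclideanSpace ℝ ι → ℝ} {c : EuclideanSpace ℝ ι} {S F : Matrix ι ι ℝ}
    (hk : IsSmoothFamily P k c r H) (hmean : ∫ x, fderiv ℝ (k x) c ∂P = 0) (hS : S.transpose = S)
    (hF : ∀ i j, F i j = ∫ x, partialDeriv (k x) i c * partialDeriv (k x) j c ∂P)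
    (hX : ∀ i, HasLaw (X i) P Pr) (hind : iIndepFun X Pr) :
    TendstoInDistribution (fun (n : ℕ) ω =>
        (√n)⁻¹ • ∑ i ∈ Finset.range n, -dualMulVec S (fderiv ℝ (k (X i ω)) c)) atTop id
      (fun _ => Pr) (multivariateGaussian 0 (S * F * S)) := by
  have : IsProbabilityMeasure P := (hX 0).isProbabilityMeasure_iff.1 inferInstance
  have hcomp : ∀ i x, (-dualMulVec S (fderiv ℝ (k x) c)) i =
      -∑ j, S i j * partialDeriv (k x) j c := fun i x => rfl
  have hL := hk.memLp_partialDeriv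
  have hint : ∀ a b, Integrable (fun x => partialDeriv (k x) a c * partialDeriv (k x) b c) P :=
    fun a b => (hL a).integrable_mul (hL b)
  refine clt_sample_multivariate hX hind (Ψ := fun x => -dualMulVec S (fderiv ℝ (k x) c))
    (fun i => ?_) (fun i => ?_) fun i j => ?_
  · simp_rw [hcomp]
    exact (memLp_finsetSum _ fun j _ => (hL j).const_mul _).neg
  · simp_rw [hcomp]
    rw [integral_neg, integral_finsetSum _ fun j _ => ((hL j).integrable (by norm_num)).const_mul _]
    simp_rw [integral_const_mul]
    have h0 : ∀ j, ∫ x, partialDeriv (k x) j c ∂P = 0 := by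
      intro j
      have := ContinuousLinearMap.integral_apply hk.integrable_fderiv (EuclideanSpace.single j 1)
      rw [hmean] at this
      exact this.symm
    simp [h0]
  · simp_rw [hcomp, neg_mul_neg, Finset.sum_mul_sum]
    have h1 : ∀ x a b, S i a * partialDeriv (k x) a c * (S j b * partialDeriv (k x) b c) =
        S i a * S j b * (partialDeriv (k x) a c * partialDeriv (k x) b c) := fun x a b => by ring
    simp_rw [h1]
    rw [integral_finsetSum _ fun a _ => integrable_finsetSum _ fun b _ => (hint a b).const_mul _]
    have h2 : ∀ a, ∫ x, ∑ b, S i a * S j b * (partialDeriv (k x) a c * partialDeriv (k x) b c) ∂P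
        = ∑ b, S i a * S j b * F a b := by
      intro a
      rw [integral_finsetSum _ fun b _ => (hint a b).const_mul _]
      simp_rw [integral_const_mul, hF]
    simp_rw [h2, Matrix.mul_apply, Finset.sum_mul]
    rw [Finset.sum_comm]
    refine Finset.sum_congr rfl fun b _ => Finset.sum_congr rfl fun a _ => ?_
    -- Symmetry of `S` turns the covariance `S F Sᵀ` into `S F S`.
    have : S j b = S b j := (congr_fun (congr_fun hS b) j)
    rw [this]; ring

theorem IsSmoothFamily.hessian_single {ι : Type*} [Fintype ι] [DecidableEq ι]
    {k : 𝒳 → EuclideanSpace ℝ ι → ℝ} {c : EuclideanSpace ℝ ι}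
    (hk : IsSmoothFamily P k c r H) (i j : ι) :
    (∫ x, fderiv ℝ (fderiv ℝ (k x)) c ∂P) (EuclideanSpace.single i 1) (EuclideanSpace.single j 1) =
      ∫ x, partialDeriv (partialDeriv (k x) j) i c ∂P := by
  rw [hk.integral_hessian_apply]
  refine integral_congr_ae ?_
  filter_upwards [hk.bounded] with x hx
  rw [partialDeriv_partialDeriv hx hk.mem_ball]

/-- The saddle point estimates are asymptotically normal. -/
theorem IsSaddleEstimate.tendstoInDistribution
    (hk : IsSmoothFamily P k (joint βs θT) r H) (hsad : IsMeanSaddle P k βs θT r)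
    (hA : ∀ i j, A i j = ∫ x, partialDeriv (partialDeriv (k x) j) i (joint βs θT) ∂P)
    (hdet : IsUnit A.det)
    (hF : ∀ i j, F i j =
      ∫ x, partialDeriv (k x) i (joint βs θT) * partialDeriv (k x) j (joint βs θT) ∂P)
    (hX : ∀ i, HasLaw (X i) P Pr) (hind : iIndepFun X Pr)
    (hest : IsSaddleEstimate Pr X k βs θT βhat αhat)
    (hmeas : ∀ n, AEMeasurable (fun ω => joint (βhat n ω) (αhat n ω (βhat n ω))) Pr) :
    HighProb Pr (fun n ω =>
      fderiv ℝ (empCriterion k X n ω) (joint (βhat n ω) (αhat n ω (βhat n ω))) = 0) ∧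
    TendstoInDistribution
      (fun (n : ℕ) ω => √(n : ℝ) • (joint (βhat n ω) (αhat n ω (βhat n ω)) - joint βs θT))
      atTop id (fun _ => Pr) (multivariateGaussian 0 (A⁻¹ * F * A⁻¹)) := by
  have : IsProbabilityMeasure P := (hX 0).isProbabilityMeasure_iff.1 inferInstance
  have hsymm := hk.integral_hessian_symm
  have hQA := fun i j => (hk.hessian_single i j).trans (hA i j).symm
  have hmean := (hk.mean_saddle_expansion hsad).1
  set Q := ∫ x, fderiv ℝ (fderiv ℝ (k x)) (joint βs θT) ∂P with hQ
  set c := joint βs θT with hc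
  have hinv := dualMulVec_inv_bilin hdet hsymm hQA
  have hnd : ∀ w, (∀ v, Q w v = 0) → w = 0 := by
    intro w hw
    rw [← hinv w, show Q w = 0 from ContinuousLinearMap.ext hw, map_zero]
  have hAsymm : A.transpose = A := by
    ext i j
    rw [Matrix.transpose_apply, ← hQA, ← hQA, hsymm]
  have hcrit := hest.highProb_fderiv_eq_zero hk hsad hnd hX hind
  refine ⟨hcrit, ?_⟩
  set S := A⁻¹ with hS
  set M := |∫ x, H x ∂P| + 1 with hM
  have hMpos : 0 < M := by positivity
  set D := ‖dualMulVec S‖ with hD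
  have hDpos : 0 ≤ D := norm_nonneg _
  -- Replacing the empirical Hessian by `Q`, and the gradient by its linearization, each costs an
  -- error proportional to `‖ĉ - c‖`, with a factor that tends to zero in probability. So the `√n`
  -- rate need not be known in advance.
  refine tendstoInDistribution_of_norm_sub_le_mul
    (hk.clt_dualMulVec hmean (by rw [hS, Matrix.transpose_nonsing_inv, hAsymm]) hF hX hind)
    (fun n => ((hmeas n).sub_const _).fun_const_smul _)
    (η := fun n ω => D * (‖fderiv ℝ (fderiv ℝ (empCriterion k X n ω)) c - Q‖ +
      M * ‖joint (βhat n ω) (αhat n ω (βhat n ω)) - c‖)) (fun ε hε => ?_) ?_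
  -- `D + 1` stands in for `D`, which may be zero.
  · have h1 := hk.highProb_bounded hX hind (δ := ε / (2 * (D + 1))) (by positivity)
    have h2 := hest.highProb_norm_sub_lt (ε := ε / (2 * (D + 1) * M)) (by positivity)
    refine (h1.and h2).mono fun n ω hω => ?_
    obtain ⟨⟨-, hω1⟩, hω2⟩ := hω
    have h3 : ‖fderiv ℝ (fderiv ℝ (empCriterion k X n ω)) c - Q‖ +
        M * ‖joint (βhat n ω) (αhat n ω (βhat n ω)) - c‖ < ε / (D + 1) := by
      calc _ < ε / (2 * (D + 1)) + M * (ε / (2 * (D + 1) * M)) := by gcongr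
        _ = ε / (D + 1) := by field_simp; ring
    calc _ ≤ D * (ε / (D + 1)) := by gcongr
      _ < (D + 1) * (ε / (D + 1)) := by gcongr; linarith
      _ = ε := by field_simp
  · have h1 := hk.highProb_bounded hX hind one_pos
    have h2 := hest.highProb_norm_sub_lt hk.pos
    have h3 := HighProb.of_ae fun n => (hk.ae_sample hX).mono fun ω hω => hω n
    refine (((h1.and h2).and h3).and hcrit).mono fun n ω hω => ?_
    obtain ⟨⟨⟨⟨hb, -⟩, hball⟩, -, hgrad, -⟩, hzero⟩ := hω
    set ĉ := joint (βhat n ω) (αhat n ω (βhat n ω)) with hĉ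
    set G := fderiv ℝ (empCriterion k X n ω) with hG
    set Qn := fderiv ℝ G c with hQn
    have h4 := hb.norm_fderiv_sub_le (convex_ball _ _) hk.mem_ball
      (mem_ball_iff_norm.2 hball)
    rw [← hG, ← hQn, hzero, zero_sub] at h4
    have hsum : (√n)⁻¹ • ∑ i ∈ Finset.range n, -dualMulVec S (fderiv ℝ (k (X i ω)) c) =
        -(√n • dualMulVec S (G c)) := by
      rw [hgrad, map_smul, map_sum, smul_smul, Finset.sum_neg_distrib, smul_neg]
      congr 2
      rcases Nat.eq_zero_or_pos n with rfl | hn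
      · simp
      have : (0 : ℝ) < n := by exact_mod_cast hn
      have h5 := Real.mul_self_sqrt this.le
      have h6 : √(n : ℝ) ≠ 0 := (Real.sqrt_pos.2 this).ne'
      rw [← div_eq_mul_inv, inv_eq_one_div, div_eq_div_iff h6 this.ne', one_mul, h5]
    have hdiff : √n • (ĉ - c) - -(√n • dualMulVec S (G c)) =
        √n • dualMulVec S (Q (ĉ - c) + G c) := by
      rw [map_add, hinv, smul_add, sub_neg_eq_add]
    rw [hsum, hdiff, norm_smul, norm_smul]
    -- Since `G ĉ = 0`, the vector `G c + Qn (ĉ - c)` is the negative of a Taylor remainder of the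
    -- gradient.
    have h7 : ‖Q (ĉ - c) + G c‖ ≤ (‖Qn - Q‖ + M * ‖ĉ - c‖) * ‖ĉ - c‖ := by
      have : Q (ĉ - c) + G c = -((Qn - Q) (ĉ - c)) - (-G c - Qn (ĉ - c)) := by
        rw [_root_.sub_apply]; abel
      rw [this]
      refine (norm_sub_le _ _).trans ?_
      rw [norm_neg]
      have h8 := (Qn - Q).le_opNorm (ĉ - c)
      linarith
    have h9 := (dualMulVec S).le_opNorm (Q (ĉ - c) + G c)
    calc ‖√(n : ℝ)‖ * ‖dualMulVec S (Q (ĉ - c) + G c)‖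
        ≤ ‖√(n : ℝ)‖ * (D * ((‖Qn - Q‖ + M * ‖ĉ - c‖) * ‖ĉ - c‖)) := by
          gcongr
          exact h9.trans (by gcongr)
      _ = _ := by ring

/-- The saddle values of the empirical criterion are asymptotically normal. -/
theorem IsSaddleEstimate.tendstoInDistribution_value
    {μ : Measure (EuclideanSpace ℝ (Fin m ⊕ Fin d))} [IsProbabilityMeasure μ]
    (hk : IsSmoothFamily P k (joint βs θT) r H)
    (hX : ∀ i, HasLaw (X i) P Pr) (hind : iIndepFun X Pr)
    (hest : IsSaddleEstimate Pr X k βs θT βhat αhat)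
    (hcrit : HighProb Pr (fun n ω =>
      fderiv ℝ (empCriterion k X n ω) (joint (βhat n ω) (αhat n ω (βhat n ω))) = 0))
    (hlim : TendstoInDistribution
      (fun (n : ℕ) ω => √(n : ℝ) • (joint (βhat n ω) (αhat n ω (βhat n ω)) - joint βs θT))
      atTop id (fun _ => Pr) μ)
    {V : ℕ → Ω → ℝ} (hVmeas : ∀ n, AEMeasurable (V n) Pr)
    (hV : HighProb Pr (fun n ω =>
      V n ω = empCriterion k X n ω (joint (βhat n ω) (αhat n ω (βhat n ω))))) :
    TendstoInDistribution
      (fun (n : ℕ) ω => √(n : ℝ) * (V n ω - ∫ x, k x (joint βs θT) ∂P)) atTop id (fun _ => Pr)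
      (gaussianReal 0 (Real.toNNReal ((∫ x, k x (joint βs θT) ^ 2 ∂P) -
        (∫ x, k x (joint βs θT) ∂P) ^ 2))) := by
  set c := joint βs θT with hc
  set Q := ∫ x, fderiv ℝ (fderiv ℝ (k x)) c ∂P with hQ
  set M := |∫ x, H x ∂P| + 1 with hM
  have hMpos : 0 < M := by positivity
  have hr := hk.pos
  set B := 1 / 2 * (‖Q‖ + 1 + M * r) + M * r with hB
  have hBpos : 0 < B := by positivity
  refine tendstoInDistribution_of_tendstoInMeasure_sub _ id (clt_sample hX hind hk.memLp) ?_
    fun n => ((hVmeas n).sub_const _).const_mul _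
  -- The error `√n B ‖ĉ - c‖ ^ 2` is split as `B ‖ĉ - c‖`, which tends to zero, times the tight `‖√n
  -- (ĉ - c)‖`.
  refine tendstoInMeasure_zero_of_norm_le_mul hlim
    (η := fun n ω => B * ‖joint (βhat n ω) (αhat n ω (βhat n ω)) - c‖) (fun ε hε => ?_) ?_
  · refine (hest.highProb_norm_sub_lt (ε := ε / B) (by positivity)).mono fun n ω hω => ?_
    calc _ < B * (ε / B) := by gcongr
      _ = ε := by field_simp
  · refine ((((hk.highProb_bounded hX hind one_pos).and (hest.highProb_norm_sub_lt hk.pos)).and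
      hcrit).and hV).mono fun n ω hω => ?_
    obtain ⟨⟨⟨⟨hb, hQn⟩, hball⟩, hzero⟩, hval⟩ := hω
    set ĉ := joint (βhat n ω) (αhat n ω (βhat n ω)) with hĉ
    set K := empCriterion k X n ω with hK
    have hmem := mem_ball_iff_norm.2 hball
    -- The expansion is taken about `ĉ`, not `c`, because the empirical gradient vanishes there; no
    -- first order term is left.
    have h1 := hb.abs_sub_le (convex_ball _ _) hmem hk.mem_ball
    rw [hzero, _root_.zero_apply, sub_zero, norm_sub_rev c ĉ] at h1
    have h2 := hb.norm_hessian_sub_le (convex_ball _ _) hk.mem_ball hmem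
    set D := fderiv ℝ (fderiv ℝ K) with hD
    have h3 : ‖D ĉ‖ ≤ ‖Q‖ + 1 + M * r := by
      have e1 : ‖D ĉ‖ ≤ ‖D ĉ - D c‖ + ‖D c‖ := norm_le_norm_sub_add _ _
      have e2 : ‖D c‖ ≤ ‖D c - Q‖ + ‖Q‖ := norm_le_norm_sub_add _ _
      have e3 : M * ‖ĉ - c‖ ≤ M * r := by gcongr
      linarith
    have h4 : |D ĉ (c - ĉ) (c - ĉ)| ≤ (‖Q‖ + 1 + M * r) * ‖ĉ - c‖ ^ 2 := by
      have := (D ĉ).le_opNorm₂ (c - ĉ) (c - ĉ)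
      rw [Real.norm_eq_abs, norm_sub_rev c ĉ] at this
      refine this.trans ?_
      rw [mul_assoc, ← sq]
      gcongr
    have h5 : M * ‖ĉ - c‖ ^ 3 ≤ M * r * ‖ĉ - c‖ ^ 2 := by
      rw [pow_succ' ‖ĉ - c‖ 2, ← mul_assoc]
      gcongr
    have h6 : |K ĉ - K c| ≤ B * ‖ĉ - c‖ ^ 2 := by
      rw [hB, abs_le]
      have e1 := abs_le.1 h1
      have e2 := abs_le.1 h4
      constructor <;> linarith [e1.1, e1.2, e2.1, e2.2]
    have h7 : √n * (V n ω - ∫ x, k x c ∂P) -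
        (√n)⁻¹ * (∑ i ∈ Finset.range n, k (X i ω) c - n * ∫ x, k x c ∂P) =
        √n * (K ĉ - K c) := by
      rw [hval]
      rcases Nat.eq_zero_or_pos n with rfl | hn
      · simp
      have hn' : (0 : ℝ) < n := by exact_mod_cast hn
      have hKc : K c = (n : ℝ)⁻¹ * ∑ i ∈ Finset.range n, k (X i ω) c := rfl
      have h6 : √(n : ℝ) ≠ 0 := (Real.sqrt_pos.2 hn').ne'
      have h5 := Real.sq_sqrt hn'.le
      rw [hKc]
      generalize √(n : ℝ) = t at h5 h6
      rw [← h5]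
      field_simp
      ring
    simp only [Pi.sub_apply]
    rw [h7, norm_mul, Real.norm_eq_abs (K ĉ - K c), norm_smul]
    calc ‖√(n : ℝ)‖ * |K ĉ - K c| ≤ ‖√(n : ℝ)‖ * (B * ‖ĉ - c‖ ^ 2) := by gcongr
      _ = _ := by ring

end Normality

/-! ### The dual representation of the divergence -/

section Duality

variable {φ : ℝ → ℝ≥0∞}

theorem IsDivergenceFunction.measurable_realPart (hφ : IsDivergenceFunction φ) :
    Measurable (realPart φ) := hφ.closed.measurable.ennreal_toReal

/-- The tangent inequality for the convex function `φ`. -/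
theorem IsDivergenceFunction.tangent_le (hφ : IsDivergenceFunction φ) {u v : ℝ}
    (hu : u ∈ interior (dom φ)) (hv : v ∈ interior (dom φ)) :
    realPart φ u + deriv (realPart φ) u * (v - u) ≤ realPart φ v := by
  have hc := hφ.strictConvex.convexOn
  have hd : DifferentiableAt ℝ (realPart φ) u :=
    (hφ.contDiff.contDiffAt (isOpen_interior.mem_nhds hu)).differentiableAt (by norm_num)
  rcases lt_trichotomy u v with h | rfl | h
  · have := hc.le_slope_of_hasDerivAt hu hv h hd.hasDerivAt
    rw [slope_def_field, le_div_iff₀ (by linarith)] at this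
    linarith
  · simp
  · have := hc.slope_le_of_hasDerivAt hv hu h hd.hasDerivAt
    rw [slope_def_field, div_le_iff₀ (by linarith)] at this
    linarith

variable {𝒳 : Type*} [MeasurableSpace 𝒳] {d : ℕ} {ν : Measure 𝒳}
  {Θ : Set (EuclideanSpace ℝ (Fin d))} {p : EuclideanSpace ℝ (Fin d) → 𝒳 → ℝ}
  {θ α θT : EuclideanSpace ℝ (Fin d)}

theorem measurable_gFun (hφ : IsDivergenceFunction φ) (hmodel : IsModel φ ν Θ p) (hθ : θ ∈ Θ)
    (hα : α ∈ Θ) : Measurable (gFun φ p θ α) := by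
  have hu := (hmodel.measurable θ hθ).div (hmodel.measurable α hα)
  exact (hu.mul ((measurable_deriv _).comp hu)).sub (hφ.measurable_realPart.comp hu)

theorem measurable_hFun (hφ : IsDivergenceFunction φ) (hmodel : IsModel φ ν Θ p) (hθ : θ ∈ Θ)
    (hα : α ∈ Θ) : Measurable (hFun φ ν p θ α) :=
  measurable_const.sub (measurable_gFun hφ hmodel hθ hα)

theorem IsModel.ae_law (hmodel : IsModel φ ν Θ p) (hT : θT ∈ Θ) :
    ∀ᵐ x ∂(law ν p θT), (∀ θ ∈ Θ, 0 < p θ x) ∧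
      ∀ θ ∈ Θ, ∀ α ∈ Θ, p θ x / p α x ∈ interior (dom φ) := by
  rw [law, ae_withDensity_iff (hmodel.measurable θT hT).ennreal_ofReal]
  filter_upwards [hmodel.support, hmodel.ratio_mem] with x h1 h2 h3
  have hpos : 0 < p θT x := by
    rw [ne_eq, ENNReal.ofReal_eq_zero, not_le] at h3
    exact h3
  exact ⟨fun θ hθ => h1 θT hT θ hθ hpos, fun θ hθ α hα => h2 θ hθ α hα (h1 θT hT θ hθ hpos)⟩

theorem IsModel.integrable_law_iff (hmodel : IsModel φ ν Θ p) (hθ : θ ∈ Θ) {k : 𝒳 → ℝ} :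
    Integrable k (law ν p θ) ↔ Integrable (fun x => p θ x * k x) ν := by
  rw [law, integrable_withDensity_iff_integrable_smul'
    (hmodel.measurable θ hθ).ennreal_ofReal (ae_of_all _ fun x => ENNReal.ofReal_lt_top)]
  simp_rw [ENNReal.toReal_ofReal (hmodel.nonneg θ hθ _), smul_eq_mul]

theorem IsModel.integral_law (hmodel : IsModel φ ν Θ p) (hθ : θ ∈ Θ) (k : 𝒳 → ℝ) :
    ∫ x, k x ∂(law ν p θ) = ∫ x, p θ x * k x ∂ν := by
  rw [law, integral_withDensity_eq_integral_toReal_smul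
    (hmodel.measurable θ hθ).ennreal_ofReal (ae_of_all _ fun x => ENNReal.ofReal_lt_top)]
  simp_rw [ENNReal.toReal_ofReal (hmodel.nonneg θ hθ _), smul_eq_mul]

/-- The change of measure from `P_θ` to `P_{θ_T}`. Where `p θT x = 0`, common support gives `p θ x =
0`, so the value of the quotient there is harmless. -/
theorem IsModel.ae_density (hmodel : IsModel φ ν Θ p) (hT : θT ∈ Θ) (hθ : θ ∈ Θ) (k : 𝒳 → ℝ) :
    (fun x => p θT x * (k x * (p θ x / p θT x))) =ᵐ[ν] fun x => p θ x * k x := by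
  filter_upwards [hmodel.support] with x hx
  rcases (hmodel.nonneg θT hT x).eq_or_lt with h | h
  · have h0 : p θ x = 0 := by
      by_contra h1
      have := hx θ hθ θT hT (lt_of_le_of_ne (hmodel.nonneg θ hθ x) (Ne.symm h1))
      linarith
    simp [h0]
  · field_simp

theorem IsModel.integrable_ratio (hmodel : IsModel φ ν Θ p) (hT : θT ∈ Θ) (hθ : θ ∈ Θ)
    {k : 𝒳 → ℝ} (hk : Integrable k (law ν p θ)) :
    Integrable (fun x => k x * (p θ x / p θT x)) (law ν p θT) :=
  (hmodel.integrable_law_iff hT).2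
    (((hmodel.integrable_law_iff hθ).1 hk).congr (hmodel.ae_density hT hθ k).symm)

theorem IsModel.integral_ratio (hmodel : IsModel φ ν Θ p) (hT : θT ∈ Θ) (hθ : θ ∈ Θ)
    (k : 𝒳 → ℝ) :
    ∫ x, k x * (p θ x / p θT x) ∂(law ν p θT) = ∫ x, k x ∂(law ν p θ) := by
  rw [hmodel.integral_law hT, hmodel.integral_law hθ]
  exact integral_congr_ae (hmodel.ae_density hT hθ k)

theorem IsModel.integrable_gFun (hmodel : IsModel φ ν Θ p) (hT : θT ∈ Θ)
    (hh : Integrable (hFun φ ν p θ α) (law ν p θT)) :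
    Integrable (gFun φ p θ α) (law ν p θT) := by
  have := hmodel.isProbabilityMeasure θT hT
  refine ((integrable_const (∫ y, fFun φ p θ α y ∂(law ν p θ))).sub hh).congr
    (ae_of_all _ fun x => ?_)
  simp [hFun]

/-- With `u = p_θ / p_α` and `v = p_θ / p_{θ_T}`, the new integrand is `φ(u) + φ'(u) (v - u)`, the
tangent line of `φ` at `u` evaluated at `v`. For `α = θ_T` it reduces to `φ(v)`. -/
theorem IsModel.integral_hFun (hmodel : IsModel φ ν Θ p) (hT : θT ∈ Θ) (hθ : θ ∈ Θ)
    (hα : α ∈ Θ) (hh : Integrable (hFun φ ν p θ α) (law ν p θT)) :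
    Integrable (fun x => fFun φ p θ α x * (p θ x / p θT x) - gFun φ p θ α x) (law ν p θT) ∧
    ∫ x, hFun φ ν p θ α x ∂(law ν p θT) =
      ∫ x, (fFun φ p θ α x * (p θ x / p θT x) - gFun φ p θ α x) ∂(law ν p θT) := by
  have := hmodel.isProbabilityMeasure θT hT
  have hg := hmodel.integrable_gFun hT hh
  have hf := hmodel.integrable_ratio hT hθ (hmodel.integrable θ hθ α hα)
  refine ⟨hf.sub hg, ?_⟩
  rw [integral_sub hf hg, hmodel.integral_ratio hT hθ]
  simp only [hFun]
  rw [integral_sub (integrable_const _) hg, integral_const]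
  simp

theorem IsModel.integral_hFun_self (hmodel : IsModel φ ν Θ p) (hT : θT ∈ Θ) (hθ : θ ∈ Θ)
    (hh : Integrable (hFun φ ν p θ θT) (law ν p θT)) :
    Integrable (fun x => realPart φ (p θ x / p θT x)) (law ν p θT) ∧
    ∫ x, hFun φ ν p θ θT x ∂(law ν p θT) =
      ∫ x, realPart φ (p θ x / p θT x) ∂(law ν p θT) := by
  have h : (fun x => fFun φ p θ θT x * (p θ x / p θT x) - gFun φ p θ θT x) =
      fun x => realPart φ (p θ x / p θT x) := by
    ext x; simp only [fFun, gFun]; ring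
  have := hmodel.integral_hFun hT hθ hT hh
  rwa [h] at this

/-- The mean of `h(θ, α)` is maximal at `α = θ_T`. -/
theorem IsModel.integral_hFun_le (hφ : IsDivergenceFunction φ) (hmodel : IsModel φ ν Θ p)
    (hT : θT ∈ Θ) (hθ : θ ∈ Θ) (hα : α ∈ Θ)
    (hh : Integrable (hFun φ ν p θ α) (law ν p θT))
    (hhT : Integrable (hFun φ ν p θ θT) (law ν p θT)) :
    ∫ x, hFun φ ν p θ α x ∂(law ν p θT) ≤ ∫ x, hFun φ ν p θ θT x ∂(law ν p θT) := by
  obtain ⟨h1, h2⟩ := hmodel.integral_hFun hT hθ hα hh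
  obtain ⟨h3, h4⟩ := hmodel.integral_hFun_self hT hθ hhT
  rw [h2, h4]
  refine integral_mono_ae h1 h3 ?_
  filter_upwards [hmodel.ae_law hT] with x hx
  have := hφ.tangent_le (hx.2 θ hθ α hα) (hx.2 θ hθ θT hT)
  simp only [fFun, gFun]
  linarith

/-- The divergence is the mean of `h(θ, θ_T)`. -/
theorem IsModel.divergence_eq (hmodel : IsModel φ ν Θ p) (hT : θT ∈ Θ) (hθ : θ ∈ Θ)
    (hh : Integrable (hFun φ ν p θ θT) (law ν p θT)) :
    divergence φ ν p θ θT = ENNReal.ofReal (∫ x, hFun φ ν p θ θT x ∂(law ν p θT)) := by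
  obtain ⟨h3, h4⟩ := hmodel.integral_hFun_self hT hθ hh
  rw [h4, ofReal_integral_eq_lintegral_ofReal h3 (ae_of_all _ fun x => ENNReal.toReal_nonneg),
    divergence]
  refine lintegral_congr_ae ?_
  filter_upwards [hmodel.ae_law hT] with x hx
  have : φ (p θ x / p θT x) ≠ ∞ := interior_subset (hx.2 θ hθ θT hT)
  rw [realPart, ENNReal.ofReal_toReal this]

theorem IsModel.integral_hFun_nonneg (hmodel : IsModel φ ν Θ p) (hT : θT ∈ Θ) (hθ : θ ∈ Θ)
    (hh : Integrable (hFun φ ν p θ θT) (law ν p θT)) :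
    0 ≤ ∫ x, hFun φ ν p θ θT x ∂(law ν p θT) := by
  rw [(hmodel.integral_hFun_self hT hθ hh).2]
  exact integral_nonneg fun x => ENNReal.toReal_nonneg

end Duality

/-! ### The minimum divergence estimates as saddle points -/

section Estimates

variable {φ : ℝ → ℝ≥0∞} {𝒳 : Type*} [MeasurableSpace 𝒳] {Ω : Type*} [MeasurableSpace Ω]
  {Pr : Measure Ω} {m d : ℕ} {ν : Measure 𝒳}
  {Θ Θ₀ : Set (EuclideanSpace ℝ (Fin d))} {p : EuclideanSpace ℝ (Fin d) → 𝒳 → ℝ}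
  {B₀ : Set (EuclideanSpace ℝ (Fin m))}
  {s : EuclideanSpace ℝ (Fin m) → EuclideanSpace ℝ (Fin d)}
  {θT : EuclideanSpace ℝ (Fin d)} {βs : EuclideanSpace ℝ (Fin m)} {X : ℕ → Ω → 𝒳}
  {βhat : ℕ → Ω → EuclideanSpace ℝ (Fin m)}
  {αhat : ℕ → Ω → EuclideanSpace ℝ (Fin m) → EuclideanSpace ℝ (Fin d)}

theorem hJoint_joint (β : EuclideanSpace ℝ (Fin m)) (α : EuclideanSpace ℝ (Fin d)) (x : 𝒳) :
    hJoint φ ν p s x (joint β α) = hFun φ ν p (s β) α x := by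
  simp [hJoint]

omit [MeasurableSpace Ω] in
theorem empCriterion_hJoint (n : ℕ) (ω : Ω) (β : EuclideanSpace ℝ (Fin m))
    (α : EuclideanSpace ℝ (Fin d)) :
    empCriterion (hJoint φ ν p s) X n ω (joint β α) = empMean X n ω (hFun φ ν p (s β) α) := by
  simp only [empCriterion, hJoint_joint]

theorem exists_ball_joint {U : Set (EuclideanSpace ℝ (Fin m))}
    {V : Set (EuclideanSpace ℝ (Fin d))} (hU : IsOpen U) (hβ : βs ∈ U) (hV : IsOpen V)
    (hT : θT ∈ V) :
    ∃ r > 0, ∀ z ∈ Metric.ball (joint βs θT) r, betaPart z ∈ U ∧ alphaPart z ∈ V := by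
  have hb : Continuous (betaPart : EuclideanSpace ℝ (Fin m ⊕ Fin d) → _) := by
    unfold betaPart; fun_prop
  have ha : Continuous (alphaPart : EuclideanSpace ℝ (Fin m ⊕ Fin d) → _) := by
    unfold alphaPart; fun_prop
  exact Metric.mem_nhds_iff.1 (((hU.preimage hb).inter (hV.preimage ha)).mem_nhds
    (show _ ∧ _ by simpa using ⟨hβ, hT⟩))

/-- The passage from the statistical model to the abstract saddle setting: a ball inside the product
of the two neighborhoods carries the smoothness, duality gives the maximum in `α`, and (C.1) the
minimum in `β`. -/
theorem exists_isSmoothFamily (hφ : IsDivergenceFunction φ) (hmodel : IsModel φ ν Θ p)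
    (hs : IsParametrization Θ Θ₀ B₀ s) (hC1 : CondC1 φ ν p B₀ s θT βs)
    (hC2 : CondC2 φ ν Θ p B₀ s θT βs) (hC3 : CondC3 φ ν p s θT βs) (hC4 : CondC4 φ ν p s θT βs) :
    ∃ r H, IsSmoothFamily (law ν p θT) (hJoint φ ν p s) (joint βs θT) r H ∧
      IsMeanSaddle (law ν p θT) (hJoint φ ν p s) βs θT r := by
  obtain ⟨U, V, G, H, hU, hβ, hUB, hV, hTV, hVΘ, -, hH, -, hsm⟩ := hC2
  obtain ⟨r, hr, hball⟩ := exists_ball_joint hU hβ hV hTV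
  have hT : θT ∈ Θ := hVΘ hTV
  have hsΘ : ∀ β ∈ U, s β ∈ Θ := fun β hβ => hs.subset (hs.image_eq ▸ mem_image_of_mem s (hUB hβ))
  have := hmodel.isProbabilityMeasure θT hT
  have hk : IsSmoothFamily (law ν p θT) (hJoint φ ν p s) (joint βs θT) r H :=
    { pos := hr
      integrable_bound := hH
      aestronglyMeasurable := fun z hz => (measurable_hFun hφ hmodel (hsΘ _ (hball z hz).1)
        (hVΘ (hball z hz).2)).aestronglyMeasurable
      bounded := by
        filter_upwards [hsm] with x hx z hz
        have := hx _ (hball z hz).1 _ (hball z hz).2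
        rwa [joint_parts] at this
      integrable_sq := by simpa only [hJoint_joint, CondC4] using hC4
      integrable_grad_sq := hC3.1
      integrable_hess := hC3.2.1 }
  have hmem : ∀ b a, ‖joint b a‖ < r → joint βs θT + joint b a ∈ Metric.ball (joint βs θT) r := by
    intro b a h
    rwa [mem_ball_iff_norm, add_sub_cancel_left]
  have hint : ∀ b a, joint b a ∈ Metric.ball (joint βs θT) r → s b ∈ Θ ∧ a ∈ Θ ∧
      Integrable (hFun φ ν p (s b) a) (law ν p θT) := by
    intro b a h
    have h1 := hball _ h
    have h2 := hk.integrable h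
    simp only [hJoint_joint] at h2
    rw [betaPart_joint, alphaPart_joint] at h1
    exact ⟨hsΘ _ h1.1, hVΘ h1.2, h2⟩
  refine ⟨r, H, hk, fun b a hba => ?_, fun b hb => ?_⟩
  · have hb : ‖joint b (0 : EuclideanSpace ℝ (Fin d))‖ < r := by
      refine lt_of_le_of_lt ?_ hba
      rw [norm_joint_zero_right, ← sq_le_sq₀ (norm_nonneg _) (norm_nonneg _), norm_joint_sq]
      linarith [sq_nonneg ‖a‖]
    have h1 := hmem b a hba
    have h2 := hmem b 0 hb
    rw [← joint_add] at h1 h2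
    rw [add_zero] at h2
    simp only [← joint_add, add_zero, hJoint_joint]
    exact hmodel.integral_hFun_le hφ hT (hint _ _ h1).1 (hint _ _ h1).2.1 (hint _ _ h1).2.2
      (hint _ _ h2).2.2
  · have h2 := hmem b 0 (by rwa [norm_joint_zero_right])
    rw [← joint_add, add_zero] at h2
    have h3 := hint _ _ hk.mem_ball
    have h4 := hint _ _ h2
    have hmin : divergence φ ν p (s βs) θT ≤ divergence φ ν p (s (βs + b)) θT :=
      hC1.2 (mem_image_of_mem s (hUB (by simpa using (hball _ h2).1)))
    rw [hmodel.divergence_eq hT h3.1 h3.2.2, hmodel.divergence_eq hT h4.1 h4.2.2,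
      ENNReal.ofReal_le_ofReal_iff (hmodel.integral_hFun_nonneg hT h4.1 h4.2.2)] at hmin
    simpa only [← joint_add, add_zero, hJoint_joint] using hmin

omit [MeasurableSpace Ω] in
theorem IsDualEstimate.divHat_eq {n : ℕ} {ω : Ω} {θ α : EuclideanSpace ℝ (Fin d)}
    (h : IsDualEstimate φ ν Θ p X n ω θ α) :
    divHat φ ν Θ p X n ω θ = (empMean X n ω (hFun φ ν p θ α) : ℝ) := by
  refine le_antisymm (iSup₂_le fun a ha => EReal.coe_le_coe_iff.2 (h.2 ha)) ?_
  exact le_iSup₂ (f := fun a _ => ((empMean X n ω (hFun φ ν p θ a) : ℝ) : EReal)) α h.1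

/-- Near `θ_T` a maximizer over `Θ` is interior, hence a local maximizer in the full space. Where
`α̂(β)` exists, the supremum is the criterion at `(β, α̂(β))`, so minimality of `β̂` compares these
values. -/
theorem CondC5.isSaddleEstimate (hB : IsOpen B₀) (hθT : θT ∈ interior Θ)
    (hC5 : CondC5 Pr φ ν Θ p B₀ s θT βs X βhat αhat) :
    IsSaddleEstimate Pr X (hJoint φ ν p s) βs θT βhat αhat where
  consistent := hC5.beta_consistent
  isLocalMax := by
    obtain ⟨ε, hε, hball⟩ := Metric.mem_nhds_iff.1 (isOpen_interior.mem_nhds hθT)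
    refine HighProb.mono (hC5.alpha_exists_consistent ε hε) fun n ω hω => ?_
    obtain ⟨h1, h2⟩ := hω.self_of_nhds
    have h3 : Θ ∈ 𝓝 (αhat n ω (βhat n ω)) :=
      mem_interior_iff_mem_nhds.1 (hball (mem_ball_iff_norm.2 h2))
    filter_upwards [h3] with a ha
    simpa only [empCriterion_hJoint, mem_ofPred_eq] using h1.2 ha
  le_of_near := fun ε hε => by
    refine (HighProb.and hC5.beta_exists (hC5.alpha_exists_consistent ε hε)).mono fun n ω hω => ?_
    obtain ⟨⟨hβ, hmin⟩, hα⟩ := hω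
    filter_upwards [hα, hB.mem_nhds hβ] with β h1 h2
    refine ⟨h1.2, ?_⟩
    have h3 : divHat φ ν Θ p X n ω (s (βhat n ω)) ≤ divHat φ ν Θ p X n ω (s β) := hmin h2
    rw [h1.1.divHat_eq, hα.self_of_nhds.1.divHat_eq, EReal.coe_le_coe_iff] at h3
    simpa only [empCriterion_hJoint] using h3

/-- Off the event where both optima are attained, `toReal` may return a default value; the
probability of this tends to zero. -/
theorem CondC5.highProb_divHatFrom (hs : IsParametrization Θ Θ₀ B₀ s)
    (hC5 : CondC5 Pr φ ν Θ p B₀ s θT βs X βhat αhat) :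
    HighProb Pr (fun n ω => (divHatFrom φ ν Θ Θ₀ p X n ω).toReal =
      empCriterion (hJoint φ ν p s) X n ω (joint (βhat n ω) (αhat n ω (βhat n ω)))) := by
  refine (HighProb.and hC5.beta_exists (hC5.alpha_exists_consistent 1 one_pos)).mono
    fun n ω hω => ?_
  obtain ⟨⟨hβ, hmin⟩, hα⟩ := hω
  have h1 : divHatFrom φ ν Θ Θ₀ p X n ω = divHat φ ν Θ p X n ω (s (βhat n ω)) := by
    rw [divHatFrom, ← hs.image_eq]
    refine le_antisymm (iInf₂_le _ (mem_image_of_mem s hβ)) (le_iInf₂ ?_)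
    rintro _ ⟨β, hβ', rfl⟩
    exact hmin hβ'
  rw [h1, hα.self_of_nhds.1.divHat_eq, EReal.toReal_coe, empCriterion_hJoint]

theorem divergenceFrom_eq (hs : IsParametrization Θ Θ₀ B₀ s) (hC1 : CondC1 φ ν p B₀ s θT βs) :
    divergenceFrom φ ν p Θ₀ θT = divergence φ ν p (s βs) θT := by
  rw [divergenceFrom, ← hs.image_eq]
  exact le_antisymm (iInf₂_le _ (mem_image_of_mem s hC1.1)) (le_iInf₂ fun θ hθ => hC1.2 hθ)

end Estimates

end PhiDivergence

/-! ### The limit theorem for the estimates and the estimated divergence. -/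

theorem mainTheorem4
    {𝒳 : Type*} [MeasurableSpace 𝒳] {Ω : Type*} [MeasurableSpace Ω]
    (Pr : Measure Ω) [IsProbabilityMeasure Pr]
    {m d : ℕ}
    (φ : ℝ → ℝ≥0∞) (hφ : IsDivergenceFunction φ)
    (ν : Measure 𝒳) [SigmaFinite ν]
    (Θ : Set (EuclideanSpace ℝ (Fin d))) (p : EuclideanSpace ℝ (Fin d) → 𝒳 → ℝ)
    (hmodel : IsModel φ ν Θ p)
    (Θ₀ : Set (EuclideanSpace ℝ (Fin d))) (B₀ : Set (EuclideanSpace ℝ (Fin m)))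
    (s : EuclideanSpace ℝ (Fin m) → EuclideanSpace ℝ (Fin d))
    (hs : IsParametrization Θ Θ₀ B₀ s)
    (θT : EuclideanSpace ℝ (Fin d)) (hθT : θT ∈ interior Θ) (hH1 : θT ∉ Θ₀)
    (X : ℕ → Ω → 𝒳) (hXindep : iIndepFun X Pr) (hXlaw : ∀ i, HasLaw (X i) (law ν p θT) Pr)
    (βs : EuclideanSpace ℝ (Fin m))
    (βhat : ℕ → Ω → EuclideanSpace ℝ (Fin m))
    (αhat : ℕ → Ω → EuclideanSpace ℝ (Fin m) → EuclideanSpace ℝ (Fin d))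
    (hβmeas : ∀ n, AEMeasurable (βhat n) Pr)
    (hαmeas : ∀ n, AEMeasurable (fun ω => αhat n ω (βhat n ω)) Pr)
    (hDmeas : ∀ n, AEMeasurable (fun ω => divHatFrom φ ν Θ Θ₀ p X n ω) Pr)
    (hC1 : CondC1 φ ν p B₀ s θT βs)
    (hC2 : CondC2 φ ν Θ p B₀ s θT βs)
    (hC3 : CondC3 φ ν p s θT βs)
    (hC4 : CondC4 φ ν p s θT βs)
    (hC5 : CondC5 Pr φ ν Θ p B₀ s θT βs X βhat αhat) :
    TendstoInDistribution
      (fun (n : ℕ) ω =>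
        √(n : ℝ) • (joint (βhat n ω) (αhat n ω (βhat n ω)) - joint βs θT))
      atTop id (fun _ => Pr)
      (multivariateGaussian 0
        ((matrixA φ ν p s θT βs)⁻¹ * matrixF φ ν p s θT βs * (matrixA φ ν p s θT βs)⁻¹)) ∧
    divergenceFrom φ ν p Θ₀ θT ≠ ∞ ∧
    TendstoInDistribution
      (fun (n : ℕ) ω =>
        √(n : ℝ) * ((divHatFrom φ ν Θ Θ₀ p X n ω).toReal -
          (divergenceFrom φ ν p Θ₀ θT).toReal))
      atTop id (fun _ => Pr)
      (gaussianReal 0 (Real.toNNReal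
        ((∫ x, (hFun φ ν p (s βs) θT x) ^ 2 ∂(law ν p θT)) -
          (∫ x, hFun φ ν p (s βs) θT x ∂(law ν p θT)) ^ 2))) := by
  have hT : θT ∈ Θ := interior_subset hθT
  have := hmodel.isProbabilityMeasure θT hT
  obtain ⟨r, H, hk, hsad⟩ := exists_isSmoothFamily hφ hmodel hs hC1 hC2 hC3 hC4
  have hest := hC5.isSaddleEstimate hs.isOpen hθT
  have hsΘ : s βs ∈ Θ := hs.subset (hs.image_eq ▸ mem_image_of_mem s hC1.1)
  have hint : Integrable (hFun φ ν p (s βs) θT) (law ν p θT) := by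
    simpa only [hJoint_joint] using hk.integrable hk.mem_ball
  -- The minimal divergence is the mean of the integrable function `h(s(β*), θ_T)`; this gives both
  -- its finiteness and the centring in (b).
  have hdiv : divergenceFrom φ ν p Θ₀ θT =
      ENNReal.ofReal (∫ x, hFun φ ν p (s βs) θT x ∂(law ν p θT)) := by
    rw [divergenceFrom_eq hs hC1, hmodel.divergence_eq hT hsΘ hint]
  obtain ⟨hcrit, hlim⟩ := hest.tendstoInDistribution hk hsad
    (A := matrixA φ ν p s θT βs) (F := matrixF φ ν p s θT βs) (fun i j => rfl) hC3.2.2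
    (fun i j => rfl) hXlaw hXindep
    (fun n => continuous_joint.measurable.comp_aemeasurable ((hβmeas n).prodMk (hαmeas n)))
  refine ⟨hlim, by rw [hdiv]; exact ENNReal.ofReal_ne_top, ?_⟩
  have hval := hest.tendstoInDistribution_value hk hXlaw hXindep hcrit hlim
    (V := fun n ω => (divHatFrom φ ν Θ Θ₀ p X n ω).toReal)
    (fun n => measurable_ereal_toReal.comp_aemeasurable (hDmeas n)) (hC5.highProb_divHatFrom hs)
  rw [hdiv, ENNReal.toReal_ofReal (hmodel.integral_hFun_nonneg hT hsΘ hint)]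
  simpa only [hJoint_joint] using hval
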